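/- Let $\mathbb S^1=\mathbb R/\mathbb Z$, identified with $[-\tfrac12,\tfrac12)$, let $Y=\mathbb S^1_x\times\mathbb S^1_y\times\mathbb R_r$ with the flat (product) metric, and let $\xi=\ker(dy-r\,dx)$. For a smooth function $f:\mathbb S^1\to\mathbb R$ put $S_f=\{(x,y,f(y)) : x,y\in\mathbb S^1\}\subset Y$, an embedded torus. A surface in $Y$ is called convex if some contact vector field on $Y$ is transverse to it, and a contact homeomorphism of $Y$ is a homeomorphism that is the uniform limit of a sequence of contactomorphisms of $(Y,\xi)$. Let $f_\infty:\mathbb S^1\to\mathbb R$ be any smooth function with $f_\infty(y)=-y^3$ for $|y|\le\tfrac14$, $f_\infty(-\tfrac12)=0$, $f_\infty'(-\tfrac12)\ne0$, $f_\infty>0$ on $(-\tfrac12,0)$ and $f_\infty<0$ on $(0,\tfrac12)$. For $0<\varepsilon<\tfrac14$ let $\mathcal C_\varepsilon(f_\infty)$ be the set of smooth $f:\mathbb S^1\to\mathbb R$ such that 1. $f(y)=f_\infty(y)$ for $y\in[-\tfrac12,\tfrac12)\setminus(-\varepsilon,\varepsilon)$, and $\max_{|y|\le\varepsilon}|f(y)|<\varepsilon$;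 2. $f(y)=-f(-y)<0$ for all $y\in(0,\varepsilon)$; 3. there is $0<\delta<\varepsilon$ with $f(y)=-y$ for all $y\in(-\delta,\delta)$. **Theorem.** For every $0<\varepsilon<\tfrac14$ and every $f\in\mathcal C_\varepsilon(f_\infty)$, the torus $S_f$ is convex, the torus $S_{f_\infty}$ is not convex, and there is a contact homeomorphism $\Phi:Y\to Y$ with $\Phi(S_f)=S_{f_\infty}$. -/

import Mathlib

open scoped ContDiff

noncomputable section

namespace ContactFlex

/-- The universal cover `ℝ³` of `T² × ℝ`, with coordinates `(x, y, r)`. -/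
abbrev Cover : Type := ℝ × ℝ × ℝ

/-- The manifold `Y = T² × ℝ = (ℝ/ℤ) × (ℝ/ℤ) × ℝ`, with the (product) flat metric. -/
abbrev Y : Type := UnitAddCircle × UnitAddCircle × ℝ

/-- The covering projection `ℝ³ → Y`. The smooth structure of `Y` is the one for which this is a
local diffeomorphism. -/
def proj (p : Cover) : Y := ((p.1 : UnitAddCircle), (p.2.1 : UnitAddCircle), p.2.2)

/-- The contact form `α = dy - r dx`, written on the cover; it is invariant under the deck
transformations, so it is a form on `Y`. -/
def contactForm (p : Cover) : Cover →L[ℝ] ℝ :=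
  (ContinuousLinearMap.fst ℝ ℝ ℝ).comp (ContinuousLinearMap.snd ℝ ℝ (ℝ × ℝ))
    - p.2.2 • ContinuousLinearMap.fst ℝ ℝ (ℝ × ℝ)

/-- `F` is a smooth lift to the cover of the map `φ : Y → Y`. As the cover is simply connected,
a map `Y → Y` is smooth exactly when it has a smooth lift. -/
def IsSmoothLift (F : Cover → Cover) (φ : Y → Y) : Prop :=
  ContDiff ℝ ∞ F ∧ ∀ p, proj (F p) = φ (proj p)

/-- `φ` is a contactomorphism of `(Y, ξ = ker α)`: a diffeomorphism whose differential carries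
the plane field `ξ` to itself. -/
def IsContactomorphism (φ : Y ≃ₜ Y) : Prop :=
  ∃ F G : Cover → Cover, IsSmoothLift F φ ∧ IsSmoothLift G φ.symm ∧
    ∀ p v : Cover, contactForm (F p) (fderiv ℝ F p v) = 0 ↔ contactForm p v = 0

/-- A contact homeomorphism: a homeomorphism which is a `C⁰`-limit (uniform limit) of a sequence
of contactomorphisms. -/
def IsContactHomeomorphism (Φ : Y ≃ₜ Y) : Prop :=
  ∃ φ : ℕ → (Y ≃ₜ Y), (∀ n, IsContactomorphism (φ n)) ∧
    TendstoUniformly (fun n => (φ n : Y → Y)) Φ Filter.atTop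

/-- A contact vector field on `Y`, given by its components in the global frame `∂x, ∂y, ∂r`:
it is smooth and `L_X α = μ α` for some function `μ`. On the cover
`(L_X α)_p (v) = (D_{X p} α) (v) + α_p (D_v X)`. The function `μ` is automatically smooth. -/
def IsContactVectorField (X : Y → Cover) : Prop :=
  ContDiff ℝ ∞ (X ∘ proj) ∧
    ∃ μ : Y → ℝ, ∀ p v : Cover,
      fderiv ℝ contactForm p (X (proj p)) v + contactForm p (fderiv ℝ (X ∘ proj) p v)
        = μ (proj p) * contactForm p v

/-- `v` is tangent to `S ⊆ Y` at the point `proj p`: it is the velocity at time `0` of a smooth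
curve contained in `S` (lifted to the cover so that it starts at `p`). For an embedded surface
`S` these vectors form its tangent plane. -/
def IsTangent (S : Set Y) (p v : Cover) : Prop :=
  ∃ γ : ℝ → Cover, ContDiff ℝ ∞ γ ∧ γ 0 = p ∧ (∀ t, proj (γ t) ∈ S) ∧ deriv γ 0 = v

/-- A surface `S ⊆ Y` is convex if there is a contact vector field transverse to it, that is,
nowhere tangent to it. -/
def IsConvexSurface (S : Set Y) : Prop :=
  ∃ X : Y → Cover, IsContactVectorField X ∧
    ∀ p : Cover, proj p ∈ S → ¬ IsTangent S p (X (proj p))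

/-- Smoothness of a function on `S¹ = ℝ/ℤ`. -/
def SmoothOnCircle (f : UnitAddCircle → ℝ) : Prop :=
  ContDiff ℝ ∞ (fun y : ℝ => f (y : UnitAddCircle))

/-- The embedded torus `S_f = {(x, y, f y) | (x, y) ∈ T²}`. -/
def torus (f : UnitAddCircle → ℝ) : Set Y :=
  Set.range (fun q : UnitAddCircle × UnitAddCircle => (q.1, q.2, f q.2))

/-- The conditions on the function `f_∞`; the circle is identified with `[-1/2, 1/2)`. -/
structure IsModel (g : UnitAddCircle → ℝ) : Prop where
  smooth : SmoothOnCircle g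
  cubic : ∀ y : ℝ, y ∈ Set.Icc (-1/4 : ℝ) (1/4) → g (y : UnitAddCircle) = -y ^ 3
  zero : g ((-1/2 : ℝ) : UnitAddCircle) = 0
  deriv_ne : deriv (fun y : ℝ => g (y : UnitAddCircle)) (-1/2) ≠ 0
  pos : ∀ y : ℝ, y ∈ Set.Ioo (-1/2 : ℝ) 0 → 0 < g (y : UnitAddCircle)
  neg : ∀ y : ℝ, y ∈ Set.Ioo (0 : ℝ) (1/2) → g (y : UnitAddCircle) < 0

/-- Membership of `f` in the class `𝒞_ε(f_∞)`, where `g = f_∞`. -/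
structure MemClass (ε : ℝ) (g f : UnitAddCircle → ℝ) : Prop where
  smooth : SmoothOnCircle f
  eq_model : ∀ y : ℝ, y ∈ Set.Ico (-1/2 : ℝ) (1/2) → y ∉ Set.Ioo (-ε) ε →
    f (y : UnitAddCircle) = g (y : UnitAddCircle)
  bound : ∀ y : ℝ, y ∈ Set.Icc (-ε) ε → |f (y : UnitAddCircle)| < ε
  odd : ∀ y : ℝ, y ∈ Set.Ioo 0 ε → f (y : UnitAddCircle) = -f ((-y : ℝ) : UnitAddCircle)
  neg : ∀ y : ℝ, y ∈ Set.Ioo 0 ε → f (y : UnitAddCircle) < 0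
  linear : ∃ δ : ℝ, 0 < δ ∧ δ < ε ∧
    ∀ y : ℝ, y ∈ Set.Ioo (-δ) δ → f (y : UnitAddCircle) = -y

end ContactFlex

end

/-!
The three assertions have independent proofs. Everything is invariant under translations in `x`, and
a contact field with Hamiltonian `H = α(X)` independent of `x` and `r` is `H ∂y + r H' ∂r`.

*`S_f` is convex.* Such a field is transverse to `S_f` when the Wronskian `f H' - f' H` has no zero
(`isConvexSurface_of_wronskian`). The function `H = -f cot (2πy)` is smooth, because `f` and
`sin (2πy)` have the same zeros and these are simple, and its Wronskian is `2π (f / sin (2πy))²`.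

*`S_g` is not convex.* Any contact field satisfies `X_r = ∂ₓ X_y` along the closed leaf `y = r = 0`;
by Rolle's theorem `X_r` vanishes at some point of the leaf, and there `X` is tangent to `S_g`
since `g' 0 = 0` (`not_isConvexSurface_of_deriv_eq_zero`).

*The contact homeomorphism.* The equation `f h' = g ∘ h` has a solution `h` which is an increasing
homeomorphism of the circle, equal to the identity outside `(-ε, ε)` and smooth except at `0`, where
its slope is infinite (`MemClass.exists_isProfile`); the oddness of `f` makes the two sides match.
A smooth `h` would give the contactomorphism `(x, y, r) ↦ (x, h y, r h' y)`, mapping `S_f` to `S_g`.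
For the actual `h` this map is not defined at `y = 0`, and it is modified away from `S_f`.

A function `T (y, R)` of the source coordinate `y` and the target coordinate `R` generates the
transformation
  `(x, y, R / (1 + T_y)) ↦ (x - T_R, y + T - R T_R, R)`,
which multiplies the contact form by `1 + T_y`; it is a contactomorphism as soon as `1 + T_y` and
`D = 1 + T_y - R T_{yR}` are positive (`MixedFamily.isContactomorphism_homeo`). For `T = h y - y` it
is the map above. Here `y + T` is instead the function `h` flattened to slope `θ` where
`h y` is small compared with a scale `m σ R`, which is comparable with `R² + σ²` near the origin:
  `y + T = θ y + (h y - θ y) S (log (h y / m))`,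
where `S` is a step from `0` to `1` with `S'' ≥ -μ S` for a small `μ`. This slowness yields `D ≥ θ`
(`le_genD`). For `σ ≠ 0` the function `T` is smooth and gives a contactomorphism. For `σ = 0` the
quantities `R / (1 + T_y)`, `T` and `T_R` are still continuous, as `T_R = O(R)`
(`exists_abs_genA_le`), and give a homeomorphism `Φ`. The family is jointly continuous in `σ`
and does not depend on `σ` for large `|r|`, so `Φ` is the uniform limit as `σ → 0`. On `S_f` one has
`R = g (h y)`, which is `-(h y)³` for `|y| < ε`, hence `m 0 R ≤ |h y|` and `T = h y - y`: thus `Φ`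
maps `S_f` to `S_g`.
-/

namespace ContactFlex

open Set Filter Topology

/-! ### Hadamard's lemma -/

/-- The powers of `t` make the statement stable under differentiation in `y`. -/
theorem contDiff_integral_pow_mul (k : ℕ) : ∀ (n : ℕ) (F : ℝ → ℝ), ContDiff ℝ ∞ F →
    ContDiff ℝ k (fun y : ℝ => ∫ t in (0:ℝ)..1, t ^ n * F (t * y)) := by
  induction k with
  | zero =>
    intro n F hF
    have := hF.continuous
    simp only [Nat.cast_zero, contDiff_zero]
    exact intervalIntegral.continuous_parametric_intervalIntegral_of_continuous' (by fun_prop) _ _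
  | succ k ih =>
    intro n F hF
    have hF' : ContDiff ℝ ∞ (deriv F) := ((contDiff_infty_iff_deriv).1 hF).2
    have key : ∀ y : ℝ, HasDerivAt (fun y : ℝ => ∫ t in (0:ℝ)..1, t ^ n * F (t * y))
        (∫ t in (0:ℝ)..1, t ^ (n + 1) * deriv F (t * y)) y := by
      intro y
      have hc := hF.continuous
      have hc' := hF'.continuous
      obtain ⟨M, hM⟩ := ((isCompact_Icc (a := (0:ℝ)) (b := 1)).prod
        (isCompact_closedBall y 1)).exists_bound_of_continuousOn
        (f := fun p : ℝ × ℝ => p.1 ^ (n + 1) * deriv F (p.1 * p.2)) (by fun_prop)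
      refine (intervalIntegral.hasDerivAt_integral_of_dominated_loc_of_deriv_le
        (F := fun y t => t ^ n * F (t * y)) (F' := fun y t => t ^ (n + 1) * deriv F (t * y))
        (bound := fun _ => M) (Metric.ball_mem_nhds y one_pos) ?_ ?_ ?_ ?_ ?_ ?_).2
      · exact .of_forall fun y => (by fun_prop : Continuous _).aestronglyMeasurable
      · exact (by fun_prop : Continuous _).intervalIntegrable _ _
      · exact (by fun_prop : Continuous _).aestronglyMeasurable
      · refine .of_forall fun t ht y' hy' => ?_
        rw [uIoc_of_le zero_le_one] at ht
        exact hM (t, y') ⟨⟨ht.1.le, ht.2⟩, Metric.ball_subset_closedBall hy'⟩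
      · simp
      · refine .of_forall fun t _ y' _ => ?_
        have h1 : HasDerivAt (fun y => F (t * y)) (deriv F (t * y') * t) y' := by
          have := ((hF.differentiable (by simp)) (t * y')).hasDerivAt
          have h2 : HasDerivAt (fun y : ℝ => t * y) t y' := by
            simpa using (hasDerivAt_id y').const_mul t
          exact this.comp y' h2
        exact (h1.const_mul (t ^ n)).congr_deriv (by ring)
    push_cast
    rw [contDiff_succ_iff_deriv]
    refine ⟨fun y => (key y).differentiableAt, by simp, ?_⟩
    rw [show deriv _ = _ from funext fun y => (key y).deriv]
    exact ih (n + 1) _ hF'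

/-- Hadamard's lemma in one variable: a smooth function vanishing at `a` is divisible by `y - a`
in the ring of smooth functions. -/
theorem exists_contDiff_eq_sub_mul {F : ℝ → ℝ} (hF : ContDiff ℝ ∞ F) {a : ℝ} (ha : F a = 0) :
    ∃ k : ℝ → ℝ, ContDiff ℝ ∞ k ∧ ∀ y, F y = (y - a) * k y := by
  have hF' : ContDiff ℝ ∞ (deriv F) := ((contDiff_infty_iff_deriv).1 hF).2
  refine ⟨fun y => ∫ t in (0:ℝ)..1, deriv F (a + t * (y - a)), ?_, fun y => ?_⟩
  · rw [contDiff_infty]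
    intro k
    have h := contDiff_integral_pow_mul k 0 (fun z => deriv F (a + z)) (by fun_prop)
    simp only [pow_zero, one_mul] at h
    exact h.comp (contDiff_id.sub contDiff_const)
  · have hc := hF'.continuous
    have hd : ∀ t ∈ uIcc (0:ℝ) 1, HasDerivAt (fun t => F (a + t * (y - a)))
        (deriv F (a + t * (y - a)) * (y - a)) t := by
      intro t _
      have h2 : HasDerivAt (fun t : ℝ => a + t * (y - a)) (y - a) t := by
        simpa using ((hasDerivAt_id t).mul_const (y - a)).const_add a
      exact ((hF.differentiable (by simp)) _).hasDerivAt.comp t h2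
    have := intervalIntegral.integral_eq_sub_of_hasDerivAt hd
      ((by fun_prop : Continuous _).intervalIntegrable _ _)
    simp only [intervalIntegral.integral_mul_const, one_mul, zero_mul, add_zero, ha, sub_zero,
      add_sub_cancel] at this
    linarith

/-! ### Quotients by functions with simple zeros -/

/-- The quotient of two functions, completed at the zeros of the denominator by the quotient of the
derivatives. -/
noncomputable def smoothQuot (F s : ℝ → ℝ) (y : ℝ) : ℝ :=
  open Classical in if s y = 0 then deriv F y / deriv s y else F y / s y

theorem contDiff_smoothQuot {F s : ℝ → ℝ} (hF : ContDiff ℝ ∞ F) (hs : ContDiff ℝ ∞ s)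
    (h : ∀ y, s y = 0 → F y = 0 ∧ deriv s y ≠ 0) : ContDiff ℝ ∞ (smoothQuot F s) := by
  rw [contDiff_iff_contDiffAt]
  intro a
  by_cases ha : s a = 0
  · obtain ⟨hFa, hsa⟩ := h a ha
    obtain ⟨k, hk, hFk⟩ := exists_contDiff_eq_sub_mul hF hFa
    obtain ⟨l, hl, hsl⟩ := exists_contDiff_eq_sub_mul hs ha
    have hder : ∀ {G k : ℝ → ℝ}, ContDiff ℝ ∞ k → (∀ y, G y = (y - a) * k y) →
        deriv G a = k a := by
      intro G k hk hG
      have h1 : HasDerivAt (fun y : ℝ => y - a) 1 a := (hasDerivAt_id a).sub_const a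
      have := h1.fun_mul ((hk.differentiable (by simp)) a).hasDerivAt
      rw [show G = fun y => (y - a) * k y from funext hG]
      simpa using this.deriv
    have hla : l a ≠ 0 := by rw [← hder hl hsl]; exact hsa
    have hev : smoothQuot F s =ᶠ[𝓝 a] fun y => k y / l y := by
      filter_upwards [hl.continuous.continuousAt.eventually_ne hla] with y hy
      unfold smoothQuot
      by_cases hya : y = a
      · subst hya
        rw [if_pos ha, hder hl hsl, hder hk hFk]
      · have : y - a ≠ 0 := sub_ne_zero.2 hya
        rw [if_neg (by rw [hsl]; positivity), hFk, hsl, mul_div_mul_left _ _ this]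
    exact (hk.contDiffAt.div hl.contDiffAt hla).congr_of_eventuallyEq hev
  · have hev : smoothQuot F s =ᶠ[𝓝 a] fun y => F y / s y := by
      filter_upwards [hs.continuous.continuousAt.eventually_ne ha] with y hy
      rw [smoothQuot, if_neg hy]
    exact (hF.contDiffAt.div hs.contDiffAt ha).congr_of_eventuallyEq hev

theorem smoothQuot_mul {F s : ℝ → ℝ} (h : ∀ y, s y = 0 → F y = 0) (y : ℝ) :
    smoothQuot F s y * s y = F y := by
  unfold smoothQuot
  split_ifs with hy
  · rw [hy, mul_zero, h y hy]
  · exact div_mul_cancel₀ _ hy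

theorem deriv_periodic {F : ℝ → ℝ} {c : ℝ} (hF : Function.Periodic F c) :
    Function.Periodic (deriv F) c := fun y => by
  rw [← deriv_comp_add_const, show (fun x => F (x + c)) = F from funext hF]

theorem smoothQuot_periodic {F s : ℝ → ℝ} {c : ℝ} (hF : Function.Periodic F c)
    (hs : Function.Periodic s c) : Function.Periodic (smoothQuot F s) c := fun y => by
  simp only [smoothQuot, hF y, hs y, deriv_periodic hF y, deriv_periodic hs y]

/-! ### Contact vector fields and convexity -/

theorem periodic_coe (f : UnitAddCircle → ℝ) :
    Function.Periodic (fun y : ℝ => f (y : UnitAddCircle)) 1 := fun y => by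
  simp only [AddCircle.coe_add_period]

theorem fderiv_contactForm (p u v : Cover) : fderiv ℝ contactForm p u v = -(u.2.2 * v.1) := by
  have h : HasFDerivAt contactForm
      (-((ContinuousLinearMap.snd ℝ ℝ ℝ ∘L ContinuousLinearMap.snd ℝ ℝ (ℝ × ℝ)).smulRight
        (ContinuousLinearMap.fst ℝ ℝ (ℝ × ℝ)))) p := by
    have h1 : HasFDerivAt (fun p : Cover => p.2.2)
      (ContinuousLinearMap.snd ℝ ℝ ℝ ∘L ContinuousLinearMap.snd ℝ ℝ (ℝ × ℝ)) p :=
      (ContinuousLinearMap.snd ℝ ℝ ℝ ∘L ContinuousLinearMap.snd ℝ ℝ (ℝ × ℝ)).hasFDerivAt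
    exact (h1.smul_const (ContinuousLinearMap.fst ℝ ℝ (ℝ × ℝ))).const_sub _
  rw [h.fderiv]
  simp

theorem contactForm_apply (p v : Cover) : contactForm p v = v.2.1 - p.2.2 * v.1 := by
  simp [contactForm]

/-- The torus is transverse to an `x`-invariant contact field `H ∂y + r H' ∂r` as soon as the
Wronskian of `f` and `H` has no zero. -/
theorem isConvexSurface_of_wronskian {f : UnitAddCircle → ℝ} (hf : SmoothOnCircle f) {H : ℝ → ℝ}
    (hH : ContDiff ℝ ∞ H) (hper : Function.Periodic H 1)
    (hW : ∀ y : ℝ, f y * deriv H y - deriv (fun y : ℝ => f y) y * H y ≠ 0) :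
    IsConvexSurface (torus f) := by
  have hH' : ContDiff ℝ ∞ (deriv H) := ((contDiff_infty_iff_deriv).1 hH).2
  let X : Y → Cover := fun q => (0, hper.lift q.2.1, q.2.2 * (deriv_periodic hper).lift q.2.1)
  have hX : X ∘ proj = fun p : Cover => (0, H p.2.1, p.2.2 * deriv H p.2.1) := by
    funext p
    simp [X, proj, Function.Periodic.lift_coe]
  refine ⟨X, ⟨?_, fun q => (deriv_periodic hper).lift q.2.1, fun p v => ?_⟩, ?_⟩
  · rw [hX]; fun_prop
  · have hd1 : HasFDerivAt (fun p : Cover => H p.2.1) (deriv H p.2.1 •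
        (ContinuousLinearMap.fst ℝ ℝ ℝ ∘L ContinuousLinearMap.snd ℝ ℝ (ℝ × ℝ))) p :=
      ((hH.differentiable (by simp)) p.2.1).hasDerivAt.comp_hasFDerivAt p
        (ContinuousLinearMap.fst ℝ ℝ ℝ ∘L ContinuousLinearMap.snd ℝ ℝ (ℝ × ℝ)).hasFDerivAt
    have hd2 : DifferentiableAt ℝ (fun p : Cover => p.2.2 * deriv H p.2.1) p :=
      ((by fun_prop : ContDiff ℝ ∞ (fun p : Cover => p.2.2 * deriv H p.2.1)).differentiable
        (by simp)) p
    have hd := (hasFDerivAt_const (0 : ℝ) p).prodMk (hd1.prodMk hd2.hasFDerivAt)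
    rw [hX, hd.fderiv, fderiv_contactForm, contactForm_apply, contactForm_apply]
    simp [X, proj, Function.Periodic.lift_coe]
    ring
  · rintro p - ⟨γ, hγ, h0, hS, hd⟩
    have hγd : HasDerivAt γ (X (proj p)) 0 := hd ▸ ((hγ.differentiable (by simp)) 0).hasDerivAt
    have hXp : X (proj p) = (0, H p.2.1, p.2.2 * deriv H p.2.1) := congrFun hX p
    have hr : ∀ t, (γ t).2.2 = f ((γ t).2.1 : ℝ) := by
      intro t
      obtain ⟨q, hq⟩ := hS t
      simp only [proj, Prod.mk.injEq] at hq
      rw [← hq.2.2, ← hq.2.1]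
    have hγy : HasDerivAt (fun t => (γ t).2.1) (H p.2.1) 0 := by
      have := (ContinuousLinearMap.fst ℝ ℝ ℝ ∘L ContinuousLinearMap.snd ℝ ℝ
        (ℝ × ℝ)).hasFDerivAt.comp_hasDerivAt (0 : ℝ) hγd
      rw [hXp] at this
      exact this
    have hγr : HasDerivAt (fun t => (γ t).2.2) (p.2.2 * deriv H p.2.1) 0 := by
      have := (ContinuousLinearMap.snd ℝ ℝ ℝ ∘L ContinuousLinearMap.snd ℝ ℝ
        (ℝ × ℝ)).hasFDerivAt.comp_hasDerivAt (0 : ℝ) hγd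
      rw [hXp] at this
      exact this
    have hfd : HasDerivAt (fun y : ℝ => f y) (deriv (fun y : ℝ => f y) p.2.1) (γ 0).2.1 := by
      rw [h0]; exact ((hf.differentiable (by simp)) p.2.1).hasDerivAt
    have h1 := hfd.comp (0 : ℝ) hγy
    have h2 := h1.unique (hγr.congr_of_eventuallyEq (.of_forall fun t => (hr t).symm))
    have h3 := hr 0
    rw [h0] at h3
    apply hW p.2.1
    rw [h2, h3]
    ring

/-- A torus with a horizontal point of the profile on the zero section is not convex: along the
closed leaf `y = a`, `r = 0` a contact field `X` satisfies `X_r = ∂ₓ X_y`, which vanishes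
somewhere by Rolle's theorem. -/
theorem not_isConvexSurface_of_deriv_eq_zero {g : UnitAddCircle → ℝ} (hg : SmoothOnCircle g)
    {a : ℝ} (h0 : g a = 0) (h1 : deriv (fun y : ℝ => g y) a = 0) :
    ¬ IsConvexSurface (torus g) := by
  rintro ⟨X, ⟨hX, μ, hμ⟩, htr⟩
  let e : Cover := (1, 0, 0)
  have hline : ∀ x : ℝ, HasDerivAt (fun x : ℝ => ((x, a, 0) : Cover)) e x := fun x =>
    (hasDerivAt_id x).prodMk ((hasDerivAt_const x a).prodMk (hasDerivAt_const x (0:ℝ)))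
  have hd : ∀ x : ℝ, HasDerivAt (fun x : ℝ => (X (proj (x, a, 0))).2.1)
      (X (proj (x, a, 0))).2.2 x := by
    intro x
    have hXd := ((hX.differentiable (by simp)) (x, a, 0)).hasFDerivAt
    have := (ContinuousLinearMap.fst ℝ ℝ ℝ ∘L ContinuousLinearMap.snd ℝ ℝ
        (ℝ × ℝ)).hasFDerivAt.comp_hasDerivAt x (hXd.comp_hasDerivAt x (hline x))
    refine this.congr_deriv ?_
    have h2 := hμ (x, a, 0) e
    rw [fderiv_contactForm, contactForm_apply, contactForm_apply] at h2
    change (fderiv ℝ (X ∘ proj) (x, a, 0) e).2.1 = _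
    dsimp only [e] at h2 ⊢
    linarith
  have hper : (X (proj (0, a, 0))).2.1 = (X (proj (1, a, 0))).2.1 := by
    have : proj (0, a, 0) = proj (1, a, 0) := by
      simp only [proj, Prod.mk.injEq, and_true]
      simpa using (AddCircle.coe_add_period (1:ℝ) 0).symm
    rw [this]
  obtain ⟨x, -, hx⟩ := exists_hasDerivAt_eq_zero (zero_lt_one' ℝ)
    (fun x _ => (hd x).continuousAt.continuousWithinAt) hper (fun x _ => hd x)
  refine htr (x, a, 0) ⟨((x : UnitAddCircle), (a : UnitAddCircle)), by simp [proj, h0]⟩ ?_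
  set V := X (proj (x, a, 0)) with hV
  refine ⟨fun t => (x + t * V.1, a + t * V.2.1, g ((a + t * V.2.1 : ℝ) : UnitAddCircle)),
    ?_, by simp [h0], fun t => ⟨(((x + t * V.1 : ℝ) : UnitAddCircle),
      ((a + t * V.2.1 : ℝ) : UnitAddCircle)), rfl⟩, ?_⟩
  · have := hg.comp (by fun_prop : ContDiff ℝ ∞ (fun t : ℝ => a + t * V.2.1))
    exact ContDiff.prodMk (by fun_prop) (ContDiff.prodMk (by fun_prop) this)
  · have d1 : ∀ c b : ℝ, HasDerivAt (fun t : ℝ => c + t * b) b 0 := fun c b => by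
      simpa using ((hasDerivAt_id (0:ℝ)).mul_const b).const_add c
    have hgd : HasDerivAt (fun y : ℝ => g y) 0 (a + 0 * V.2.1) := by
      rw [zero_mul, add_zero, ← h1]; exact ((hg.differentiable (by simp)) a).hasDerivAt
    have d2 := hgd.comp (0:ℝ) (d1 a V.2.1)
    have := ((d1 x V.1).prodMk ((d1 a V.2.1).prodMk d2)).deriv
    refine this.trans ?_
    rw [zero_mul, ← hx]

/-! ### Convexity of the torus of a function in the class -/

namespace MemClass
variable {g f : UnitAddCircle → ℝ} {ε : ℝ}

theorem apply_zero (hf : MemClass ε g f) : f ((0 : ℝ) : UnitAddCircle) = 0 := by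
  obtain ⟨δ, hδ, -, h⟩ := hf.linear
  simpa using h 0 ⟨by linarith, hδ⟩

theorem neg_of_pos (hf : MemClass ε g f) (hg : IsModel g) {y : ℝ} (hy : y ∈ Ioo (0 : ℝ) (1 / 2)) :
    f (y : UnitAddCircle) < 0 := by
  by_cases h : y < ε
  · exact hf.neg y ⟨hy.1, h⟩
  · rw [hf.eq_model y ⟨by linarith [hy.1], hy.2⟩ fun h' => h h'.2]
    exact hg.neg y hy

theorem pos_of_neg (hf : MemClass ε g f) (hg : IsModel g) {y : ℝ}
    (hy : y ∈ Ioo (-1 / 2 : ℝ) 0) : 0 < f (y : UnitAddCircle) := by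
  by_cases h : -ε < y
  · have h1 := hf.odd (-y) ⟨by linarith [hy.2], by linarith⟩
    have h2 := hf.neg (-y) ⟨by linarith [hy.2], by linarith⟩
    rw [neg_neg] at h1
    linarith
  · rw [hf.eq_model y ⟨hy.1.le, by linarith [hy.2]⟩ fun h' => h h'.1]
    exact hg.pos y hy

theorem apply_neg_half (hf : MemClass ε g f) (hg : IsModel g) (hε : ε < 1 / 4) :
    f ((-1 / 2 : ℝ) : UnitAddCircle) = 0 := by
  rw [hf.eq_model _ ⟨le_rfl, by norm_num⟩ fun h' => by linarith [h'.1], hg.zero]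

theorem eventuallyEq_neg_half (hf : MemClass ε g f) (hε' : ε < 1 / 4) :
    (fun y : ℝ => f (y : UnitAddCircle)) =ᶠ[𝓝 (-1 / 2)] fun y : ℝ => g (y : UnitAddCircle) := by
  filter_upwards [Ioo_mem_nhds (show (-3 / 4 : ℝ) < -1 / 2 by norm_num)
    (show (-1 / 2 : ℝ) < -1 / 4 by norm_num)] with y hy
  by_cases h : -1 / 2 ≤ y
  · exact hf.eq_model y ⟨h, by linarith [hy.2]⟩ fun h' => by linarith [h'.1, hy.2]
  · rw [← AddCircle.coe_add_period 1 y]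
    exact hf.eq_model _ ⟨by linarith [hy.1], by linarith⟩ fun h' => by linarith [h'.2, hy.1]

theorem deriv_neg_half_pos (hf : MemClass ε g f) (hg : IsModel g) (hε' : ε < 1 / 4) :
    0 < deriv (fun y : ℝ => f (y : UnitAddCircle)) (-1 / 2) := by
  refine lt_of_le_of_ne ?_ ?_
  · have hd := ((hf.smooth.differentiable (by simp)) (-1 / 2)).hasDerivAt
    refine ge_of_tendsto ((hasDerivAt_iff_tendsto_slope.1 hd).mono_left (nhdsGT_le_nhdsNE _)) ?_
    filter_upwards [Ioo_mem_nhdsGT (show (-1 / 2 : ℝ) < 0 by norm_num)] with y hy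
    rw [slope_def_field, hf.apply_neg_half hg hε', sub_zero]
    exact (div_pos (hf.pos_of_neg hg hy) (by linarith [hy.1])).le
  · rw [(hf.eventuallyEq_neg_half hε').deriv_eq]
    exact hg.deriv_ne.symm

theorem deriv_zero (hf : MemClass ε g f) : deriv (fun y : ℝ => f (y : UnitAddCircle)) 0 = -1 := by
  obtain ⟨δ, hδ, -, h⟩ := hf.linear
  have : (fun y : ℝ => f (y : UnitAddCircle)) =ᶠ[𝓝 0] fun y => -y := by
    filter_upwards [Ioo_mem_nhds (show -δ < 0 by linarith) hδ] with y hy using h y hy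
  rw [this.deriv_eq]
  simp

end MemClass

theorem exists_int_add_mem_Ico (y : ℝ) : ∃ (n : ℤ) (z : ℝ), z ∈ Ico (-1 / 2 : ℝ) (1 / 2) ∧
    y = z + n * 1 := by
  refine ⟨round y, y - round y, ?_, by ring⟩
  have := (round_eq_iff (x := y)).1 rfl
  constructor <;> linarith [this.1, this.2]

open Real in
/-- The Wronskian of `f` and `H = -f cot (2πy)` is `2π (f / sin (2πy))²`; this is nonzero because
`f` and `sin (2πy)` have the same zeros, all of them simple. -/
theorem MemClass.isConvexSurface {g f : UnitAddCircle → ℝ} {ε : ℝ} (hg : IsModel g)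
    (hε : ε < 1 / 4) (hf : MemClass ε g f) : IsConvexSurface (torus f) := by
  set F : ℝ → ℝ := fun y => f (y : UnitAddCircle) with hF
  set s : ℝ → ℝ := fun y => sin (2 * π * y) with hs
  have hFs : ContDiff ℝ ∞ F := hf.smooth
  have hss : ContDiff ℝ ∞ s := by fun_prop
  have hFp : Function.Periodic F 1 := periodic_coe f
  have hsp : Function.Periodic s 1 := fun y => by
    simp only [hs, mul_add, mul_one, sin_add_two_pi]
  have hsd : ∀ y, HasDerivAt s (2 * π * cos (2 * π * y)) y := fun y => by
    have h1 : HasDerivAt (fun y : ℝ => 2 * π * y) (2 * π) y := by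
      simpa using (hasDerivAt_id y).const_mul (2 * π)
    exact h1.sin.congr_deriv (by ring)
  have hcd : ∀ y, HasDerivAt (fun y => cos (2 * π * y)) (-(2 * π * s y)) y := fun y => by
    have h1 : HasDerivAt (fun y : ℝ => 2 * π * y) (2 * π) y := by
      simpa using (hasDerivAt_id y).const_mul (2 * π)
    exact h1.cos.congr_deriv (by simp only [hs]; ring)
  have hpi := pi_pos
  -- signs on a fundamental domain
  have hcases : ∀ z ∈ Ico (-1 / 2 : ℝ) (1 / 2), smoothQuot F s z < 0 ∧
      (s z = 0 → F z = 0 ∧ deriv s z ≠ 0) := by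
    intro z hz
    rcases eq_or_lt_of_le hz.1 with h | h
    · subst h
      have h0 : s (-1 / 2) = 0 := by
        simp only [hs]; rw [show 2 * π * (-1 / 2) = -π by ring, sin_neg, sin_pi, neg_zero]
      have h1 : deriv s (-1 / 2) = -(2 * π) := by
        rw [(hsd _).deriv, show 2 * π * (-1 / 2) = -π by ring, cos_neg, cos_pi]; ring
      refine ⟨?_, fun _ => ⟨hf.apply_neg_half hg hε, by rw [h1]; linarith⟩⟩
      rw [smoothQuot, if_pos h0, h1]
      exact div_neg_of_pos_of_neg (hf.deriv_neg_half_pos hg hε) (by linarith)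
    · rcases lt_trichotomy z 0 with h' | h' | h'
      · have hs0 : s z < 0 := sin_neg_of_neg_of_neg_pi_lt (by nlinarith) (by nlinarith)
        refine ⟨?_, fun h => absurd h hs0.ne⟩
        rw [smoothQuot, if_neg hs0.ne]
        exact div_neg_of_pos_of_neg (hf.pos_of_neg hg ⟨h, h'⟩) hs0
      · subst h'
        have h0 : s 0 = 0 := by simp [hs]
        have h1 : deriv s 0 = 2 * π := by rw [(hsd _).deriv]; simp
        refine ⟨?_, fun _ => ⟨hf.apply_zero, by rw [h1]; linarith⟩⟩
        rw [smoothQuot, if_pos h0, h1, hf.deriv_zero]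
        exact div_neg_of_neg_of_pos (by norm_num) (by linarith)
      · have hs0 : 0 < s z := sin_pos_of_pos_of_lt_pi (by nlinarith) (by nlinarith [hz.2])
        refine ⟨?_, fun h => absurd h hs0.ne'⟩
        rw [smoothQuot, if_neg hs0.ne']
        exact div_neg_of_neg_of_pos (hf.neg_of_pos hg ⟨h', hz.2⟩) hs0
  have hall : ∀ y, smoothQuot F s y < 0 ∧ (s y = 0 → F y = 0 ∧ deriv s y ≠ 0) := by
    intro y
    obtain ⟨n, z, hz, rfl⟩ := exists_int_add_mem_Ico y
    have := hcases z hz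
    rwa [(smoothQuot_periodic hFp hsp).int_mul n z, hFp.int_mul n z, hsp.int_mul n z,
      (deriv_periodic hsp).int_mul n z]
  have hk : ContDiff ℝ ∞ (smoothQuot F s) := contDiff_smoothQuot hFs hss fun y => (hall y).2
  have hks : ∀ y, smoothQuot F s y * s y = F y := smoothQuot_mul fun y h => ((hall y).2 h).1
  set k := smoothQuot F s
  refine isConvexSurface_of_wronskian hf.smooth (H := fun y => -(k y * cos (2 * π * y)))
    (by fun_prop) (fun y => ?_) fun y => ?_
  · simp only [k, smoothQuot_periodic hFp hsp y, mul_add, mul_one, cos_add_two_pi]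
  · have hkd := ((hk.differentiable (by simp)) y).hasDerivAt
    have e1 := (hkd.fun_mul (hcd y)).fun_neg.deriv
    have e2 := (hkd.fun_mul (hsd y)).deriv
    rw [show (fun y => k y * s y) = F from funext hks] at e2
    change F y * _ - deriv F y * _ ≠ 0
    rw [e1, e2, ← hks y]
    have : 0 < 2 * π * k y ^ 2 := by have := (hall y).1.ne; positivity
    have hsc : s y ^ 2 + cos (2 * π * y) ^ 2 = 1 := sin_sq_add_cos_sq _
    refine ne_of_gt (this.trans_eq ?_)
    linear_combination (-2 * π * k y ^ 2) * hsc

theorem IsModel.not_isConvexSurface {g : UnitAddCircle → ℝ} (hg : IsModel g) :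
    ¬ IsConvexSurface (torus g) := by
  refine not_isConvexSurface_of_deriv_eq_zero hg.smooth (a := 0) ?_ ?_
  · simpa using hg.cubic 0 (by norm_num)
  · have : (fun y : ℝ => g (y : UnitAddCircle)) =ᶠ[𝓝 0] fun y => -y ^ 3 := by
      filter_upwards [Icc_mem_nhds (show (-1 / 4 : ℝ) < 0 by norm_num)
        (show (0 : ℝ) < 1 / 4 by norm_num)] with y hy using hg.cubic y hy
    rw [this.deriv_eq]
    simp

/-! ### Inverting a family of increasing functions -/

/-- The inverse of the bijection `c z` of the real line, as a function of the parameter `z` and the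
value. -/
noncomputable def fiberInv {Z : Type*} (c : Z → ℝ → ℝ) (z : Z) : ℝ → ℝ := Function.invFun (c z)

section fiberInv
variable {Z : Type*} {c : Z → ℝ → ℝ}

theorem apply_fiberInv {z : Z} (h : Function.Surjective (c z)) (r : ℝ) : c z (fiberInv c z r) = r :=
  Function.rightInverse_invFun h r

theorem fiberInv_apply {z : Z} (h : StrictMono (c z)) (r : ℝ) : fiberInv c z (c z r) = r :=
  Function.leftInverse_invFun h.injective r

theorem fiberInv_eq {z : Z} (h : StrictMono (c z)) {r s : ℝ} (hs : c z s = r) :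
    fiberInv c z r = s := by rw [← hs, fiberInv_apply h]

theorem continuous_fiberInv [TopologicalSpace Z] (hc : Continuous ↿c)
    (hm : ∀ z, StrictMono (c z)) (hs : ∀ z, Function.Surjective (c z)) :
    Continuous ↿(fiberInv c) := by
  have hcz : ∀ R : ℝ, Continuous fun p : Z × ℝ => c p.1 R := fun R =>
    hc.comp (by fun_prop : Continuous fun p : Z × ℝ => (p.1, R))
  rw [continuous_iff_continuousAt]
  rintro ⟨z, r⟩
  refine tendsto_order.2 ⟨fun a ha => ?_, fun a ha => ?_⟩
  · have h1 : c z a < r := by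
      have := hm z ha
      rwa [show ↿(fiberInv c) (z, r) = fiberInv c z r from rfl, apply_fiberInv (hs z)] at this
    filter_upwards [(hcz a).continuousAt.eventually_lt (x₀ := (z, r))
      continuous_snd.continuousAt h1] with p hp
    rw [← apply_fiberInv (hs p.1) p.2] at hp
    exact (hm p.1).lt_iff_lt.1 hp
  · have h1 : r < c z a := by
      have := hm z ha
      rwa [show ↿(fiberInv c) (z, r) = fiberInv c z r from rfl, apply_fiberInv (hs z)] at this
    filter_upwards [continuous_snd.continuousAt.eventually_lt (x₀ := (z, r))
      (hcz a).continuousAt h1] with p hp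
    rw [← apply_fiberInv (hs p.1) p.2] at hp
    exact (hm p.1).lt_iff_lt.1 hp

/-- Smooth dependence of the inverse on the parameter, by the inverse function theorem for
`(z, R) ↦ (z, c z R)`. -/
theorem contDiff_fiberInv {c c' : ℝ → ℝ → ℝ} (hc : ContDiff ℝ ∞ ↿c)
    (hd : ∀ z R, HasDerivAt (c z) (c' z R) R) (hpos : ∀ z R, 0 < c' z R)
    (hs : ∀ z, Function.Surjective (c z)) : ContDiff ℝ ∞ ↿(fiberInv c) := by
  have hm : ∀ z, StrictMono (c z) := fun z =>
    strictMono_of_deriv_pos fun R => by rw [(hd z R).deriv]; exact hpos z R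
  let e : ℝ × ℝ ≃ₜ ℝ × ℝ :=
    { toFun := fun p => (p.1, c p.1 p.2)
      invFun := fun p => (p.1, fiberInv c p.1 p.2)
      left_inv := fun p => by simp [fiberInv_apply (hm _)]
      right_inv := fun p => by simp [apply_fiberInv (hs _)]
      continuous_toFun := continuous_fst.prodMk hc.continuous
      continuous_invFun := continuous_fst.prodMk (continuous_fiberInv hc.continuous hm hs) }
  have hsm : ContDiff ℝ ∞ e := contDiff_fst.prodMk hc
  have key : ContDiff ℝ ∞ e.symm := by
    rw [contDiff_iff_contDiffAt]
    intro q
    set p := e.symm q with hp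
    have hcd := ((hc.differentiable (by simp)) p).hasFDerivAt
    set L := fderiv ℝ ↿c p with hL
    have hL2 : ∀ b : ℝ, L (0, b) = b * c' p.1 p.2 := by
      intro b
      have h1 : HasDerivAt (fun R : ℝ => (p.1, R)) ((0 : ℝ), (1 : ℝ)) p.2 :=
        (hasDerivAt_const _ _).prodMk (hasDerivAt_id _)
      have h2 : L (0, 1) = c' p.1 p.2 :=
        (HasFDerivAt.comp_hasDerivAt p.2 (f := fun R : ℝ => (p.1, R)) hcd h1).unique (hd p.1 p.2)
      rw [← h2, show ((0 : ℝ), b) = b • ((0 : ℝ), (1 : ℝ)) by simp, map_smul, smul_eq_mul]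
    have hLs : ∀ a b : ℝ, L (a, b) = L (a, 0) + b * c' p.1 p.2 := by
      intro a b
      rw [← hL2, ← map_add]; simp
    have hne := (hpos p.1 p.2).ne'
    let M : (ℝ × ℝ) ≃L[ℝ] (ℝ × ℝ) := ContinuousLinearEquiv.equivOfInverse
      ((ContinuousLinearMap.fst ℝ ℝ ℝ).prod L)
      ((ContinuousLinearMap.fst ℝ ℝ ℝ).prod ((c' p.1 p.2)⁻¹ •
        (ContinuousLinearMap.snd ℝ ℝ ℝ - L ∘L ((ContinuousLinearMap.inl ℝ ℝ ℝ) ∘L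
          ContinuousLinearMap.fst ℝ ℝ ℝ))))
      (fun v => by
        obtain ⟨a, b⟩ := v
        simp [hLs a b]
        field_simp)
      (fun v => by
        obtain ⟨a, b⟩ := v
        simp only [ContinuousLinearMap.prod_apply, ContinuousLinearMap.coe_fst']
        rw [hLs]
        simp
        field_simp
        ring)
    exact e.toOpenPartialHomeomorph.contDiffAt_symm (f₀' := M) (mem_univ _)
      (hasFDerivAt_fst.prodMk hcd) hsm.contDiffAt
  exact contDiff_snd.comp key

end fiberInv

/-! ### Maps of the quotient given by equivariant maps of the cover -/

theorem isOpenQuotientMap_proj : IsOpenQuotientMap proj :=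
  have h : IsOpenQuotientMap ((↑) : ℝ → UnitAddCircle) := QuotientAddGroup.isOpenQuotientMap_mk
  h.prodMap (h.prodMap .id)

theorem proj_add (p : Cover) (k l : ℤ) : proj (p + ((k : ℝ), (l : ℝ), 0)) = proj p := by
  have h : ∀ (x : ℝ) (n : ℤ), ((x + n : ℝ) : UnitAddCircle) = x := fun x n => by
    simp
  simp [proj, h]

theorem exists_of_proj_eq {p q : Cover} (h : proj p = proj q) :
    ∃ k l : ℤ, p = q + ((k : ℝ), (l : ℝ), 0) := by
  simp only [proj, Prod.mk.injEq] at h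
  obtain ⟨h1, h2, h3⟩ := h
  rw [← sub_eq_zero, ← AddCircle.coe_sub, AddCircle.coe_eq_zero_iff] at h1 h2
  obtain ⟨k, hk⟩ := h1
  obtain ⟨l, hl⟩ := h2
  simp at hk hl
  refine ⟨k, l, Prod.ext ?_ (Prod.ext ?_ ?_)⟩ <;> simp <;> linarith

/-- Invariance of a self-map of the cover under the deck transformations. -/
def IsEquivariant (F : Cover → Cover) : Prop :=
  ∀ p (k l : ℤ), F (p + ((k : ℝ), (l : ℝ), 0)) = F p + ((k : ℝ), (l : ℝ), 0)

/-- The self-map of `Y` induced by an equivariant self-map of the cover. -/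
noncomputable def descend (F : Cover → Cover) (q : Y) : Y :=
  proj (F (Function.surjInv isOpenQuotientMap_proj.surjective q))

theorem descend_proj {F : Cover → Cover} (hF : IsEquivariant F) (p : Cover) :
    descend F (proj p) = proj (F p) := by
  obtain ⟨k, l, h⟩ := exists_of_proj_eq
    (Function.surjInv_eq isOpenQuotientMap_proj.surjective (proj p))
  rw [descend, h, hF, proj_add]

theorem continuous_descend {Z : Type*} [TopologicalSpace Z] {F : Z → Cover → Cover}
    (hF : ∀ z, IsEquivariant (F z)) (hc : Continuous ↿F) :
    Continuous ↿(fun z => descend (F z)) := by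
  rw [← ((IsOpenQuotientMap.id (X := Z)).prodMap isOpenQuotientMap_proj).continuous_comp_iff]
  have : ↿(fun z => descend (F z)) ∘ Prod.map id proj = fun p : Z × Cover => proj (↿F p) :=
    funext fun p => descend_proj (hF p.1) p.2
  rw [this]
  exact isOpenQuotientMap_proj.continuous.comp hc

/-- The homeomorphism of `Y` induced by mutually inverse equivariant maps of the cover. -/
noncomputable def descendHomeomorph (F G : Cover → Cover) (hF : IsEquivariant F)
    (hG : IsEquivariant G) (hFc : Continuous F) (hGc : Continuous G)
    (hGF : ∀ p, G (F p) = p) (hFG : ∀ p, F (G p) = p) : Y ≃ₜ Y where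
  toFun := descend F
  invFun := descend G
  left_inv q := by
    obtain ⟨p, rfl⟩ := isOpenQuotientMap_proj.surjective q
    rw [descend_proj hF, descend_proj hG, hGF]
  right_inv q := by
    obtain ⟨p, rfl⟩ := isOpenQuotientMap_proj.surjective q
    rw [descend_proj hG, descend_proj hF, hFG]
  continuous_toFun := (continuous_descend (Z := Unit) (F := fun _ => F) (fun _ => hF)
    (hFc.comp continuous_snd)).comp (Continuous.prodMk_right ())
  continuous_invFun := (continuous_descend (Z := Unit) (F := fun _ => G) (fun _ => hG)
    (hGc.comp continuous_snd)).comp (Continuous.prodMk_right ())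

/-! ### Families of homeomorphisms in mixed coordinates -/

/-- A family, indexed by `σ : ℝ`, of `x`-invariant homeomorphisms of `T² × ℝ`, presented in the
mixed coordinates `(y, R)`, where `y` belongs to the source and `R` to the target: the point
`(x, y, C σ y R)` is sent to `(x + A σ y R, B σ y R, R)`. The family is constant in `σ` for
`1 ≤ |R|`, which makes its continuity uniform although `Y` is not compact. -/
structure MixedFamily (A B C : ℝ → ℝ → ℝ → ℝ) : Prop where
  continuous_A : Continuous ↿A
  continuous_B : Continuous ↿B
  continuous_C : Continuous ↿C
  A_periodic : ∀ σ R, Function.Periodic (fun y => A σ y R) 1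
  B_periodic : ∀ σ R, Function.Periodic (fun y => B σ y R - y) 1
  C_periodic : ∀ σ R, Function.Periodic (fun y => C σ y R) 1
  B_strictMono : ∀ σ R, StrictMono fun y => B σ y R
  C_strictMono : ∀ σ y, StrictMono (C σ y)
  C_surjective : ∀ σ y, Function.Surjective (C σ y)
  A_stable : ∀ σ y R, 1 ≤ |R| → A σ y R = A 0 y R
  B_stable : ∀ σ y R, 1 ≤ |R| → B σ y R = B 0 y R
  C_stable : ∀ σ y R, 1 ≤ |R| → C σ y R = C 0 y R

namespace MixedFamily

/-- The lift to the cover of the homeomorphism of index `σ`. -/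
noncomputable def lift (A B C : ℝ → ℝ → ℝ → ℝ) (σ : ℝ) (p : Cover) : Cover :=
  let R := fiberInv (C σ) p.2.1 p.2.2
  (p.1 + A σ p.2.1 R, B σ p.2.1 R, R)

/-- The inverse of `MixedFamily.lift`. -/
noncomputable def invLift (A B C : ℝ → ℝ → ℝ → ℝ) (σ : ℝ) (p : Cover) : Cover :=
  let y := fiberInv (fun R y => B σ y R) p.2.2 p.2.1
  (p.1 - A σ y p.2.2, y, C σ y p.2.2)

variable {A B C : ℝ → ℝ → ℝ → ℝ} (h : MixedFamily A B C)
include h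

theorem B_add_int (σ R y : ℝ) (n : ℤ) : B σ (y + n) R = B σ y R + n := by
  have := (h.B_periodic σ R).int_mul n y
  simp only [mul_one] at this
  linarith

theorem B_surjective (σ R : ℝ) : Function.Surjective fun y => B σ y R := by
  intro v
  obtain ⟨n, hn⟩ := exists_nat_ge |v - B σ 0 R|
  have hc : Continuous fun y => B σ y R :=
    h.continuous_B.comp (by fun_prop : Continuous fun y : ℝ => (σ, y, R))
  have h1 := h.B_add_int σ R 0 n
  have h2 := h.B_add_int σ R 0 (-n)
  obtain ⟨y, -, hy⟩ := intermediate_value_Icc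
    (show ((-n : ℤ) : ℝ) ≤ ((n : ℤ) : ℝ) by push_cast; linarith [n.cast_nonneg (α := ℝ)])
    hc.continuousOn (show v ∈ Icc _ _ by
      rw [zero_add] at h1 h2
      simp only [h1, h2]
      push_cast
      have := abs_le.1 hn
      constructor <;> linarith)
  exact ⟨y, hy⟩

theorem continuous_fiberInv_C : Continuous fun p : ℝ × ℝ × ℝ => fiberInv (C p.1) p.2.1 p.2.2 := by
  have := continuous_fiberInv (c := fun z : ℝ × ℝ => C z.1 z.2)
    (h.continuous_C.comp (by fun_prop : Continuous fun p : (ℝ × ℝ) × ℝ => (p.1.1, p.1.2, p.2)))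
    (fun z => h.C_strictMono _ _) (fun z => h.C_surjective _ _)
  exact this.comp (by fun_prop : Continuous fun p : ℝ × ℝ × ℝ => ((p.1, p.2.1), p.2.2))

theorem continuous_lift : Continuous ↿(lift A B C) := by
  have hR : Continuous fun p : ℝ × Cover => fiberInv (C p.1) p.2.2.1 p.2.2.2 :=
    h.continuous_fiberInv_C.comp (by fun_prop : Continuous fun p : ℝ × Cover =>
      (p.1, p.2.2.1, p.2.2.2))
  have hp : Continuous fun p : ℝ × Cover =>
      (p.1, p.2.2.1, fiberInv (C p.1) p.2.2.1 p.2.2.2) := by fun_prop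
  exact ((by fun_prop : Continuous fun p : ℝ × Cover => p.2.1).add
    (h.continuous_A.comp hp)).prodMk ((h.continuous_B.comp hp).prodMk hR)

theorem continuous_invLift (σ : ℝ) : Continuous (invLift A B C σ) := by
  have hR : Continuous fun p : Cover => fiberInv (fun R y => B σ y R) p.2.2 p.2.1 :=
    (continuous_fiberInv (c := fun R y => B σ y R)
    (h.continuous_B.comp (by fun_prop : Continuous fun p : ℝ × ℝ => (σ, p.2, p.1)))
    (fun z => h.B_strictMono _ _) (fun z => h.B_surjective _ _)).comp
      (by fun_prop : Continuous fun p : Cover => (p.2.2, p.2.1))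
  have hp : Continuous fun p : Cover =>
      (σ, fiberInv (fun R y => B σ y R) p.2.2 p.2.1, p.2.2) := by fun_prop
  exact ((by fun_prop : Continuous fun p : Cover => p.1).sub
    (h.continuous_A.comp hp)).prodMk (hR.prodMk (h.continuous_C.comp hp))

theorem invLift_lift (σ : ℝ) (p : Cover) : invLift A B C σ (lift A B C σ p) = p := by
  have h1 := fiberInv_apply (c := fun R y => B σ y R)
    (h.B_strictMono σ (fiberInv (C σ) p.2.1 p.2.2)) p.2.1
  simp only [invLift, lift, h1, apply_fiberInv (h.C_surjective σ p.2.1), add_sub_cancel_right]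

theorem lift_invLift (σ : ℝ) (p : Cover) : lift A B C σ (invLift A B C σ p) = p := by
  have h1 := apply_fiberInv (c := fun R y => B σ y R) (h.B_surjective σ p.2.2) p.2.1
  simp only [invLift, lift, h1, fiberInv_apply (h.C_strictMono σ _), sub_add_cancel]

theorem isEquivariant_lift (σ : ℝ) : IsEquivariant (lift A B C σ) := by
  intro p k l
  have hR : fiberInv (C σ) (p.2.1 + l) p.2.2 = fiberInv (C σ) p.2.1 p.2.2 :=
    fiberInv_eq (h.C_strictMono σ _) (by
      have := (h.C_periodic σ (fiberInv (C σ) p.2.1 p.2.2)).int_mul l p.2.1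
      simp only [mul_one] at this
      rw [this, apply_fiberInv (h.C_surjective σ _)])
  have hA : A σ (p.2.1 + l) (fiberInv (C σ) p.2.1 p.2.2) =
      A σ p.2.1 (fiberInv (C σ) p.2.1 p.2.2) := by
    simpa using (h.A_periodic σ (fiberInv (C σ) p.2.1 p.2.2)).int_mul l p.2.1
  simp only [lift, Prod.fst_add, Prod.snd_add, add_zero, hR, hA, h.B_add_int]
  ext <;> simp
  ring

theorem isEquivariant_invLift (σ : ℝ) : IsEquivariant (invLift A B C σ) := by
  intro p k l
  rw [← h.invLift_lift σ (invLift A B C σ p + _), h.isEquivariant_lift, h.lift_invLift]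

/-- The homeomorphism of `Y` of index `σ`. -/
noncomputable def homeo (σ : ℝ) : Y ≃ₜ Y :=
  descendHomeomorph (lift A B C σ) (invLift A B C σ) (h.isEquivariant_lift σ)
    (h.isEquivariant_invLift σ) (h.continuous_lift.comp (Continuous.prodMk_right σ))
    (h.continuous_invLift σ) (h.invLift_lift σ) (h.lift_invLift σ)

theorem homeo_proj (σ : ℝ) (p : Cover) : h.homeo σ (proj p) = proj (lift A B C σ p) :=
  descend_proj (h.isEquivariant_lift σ) p

theorem homeo_symm_proj (σ : ℝ) (p : Cover) :
    (h.homeo σ).symm (proj p) = proj (invLift A B C σ p) :=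
  descend_proj (h.isEquivariant_invLift σ) p

/-- Points with a large `r`-coordinate are moved independently of `σ`. -/
theorem exists_lift_eq : ∃ M : ℝ, ∀ (σ : ℝ) (p : Cover), M < |p.2.2| →
    lift A B C σ p = lift A B C 0 p := by
  have hc : ∀ R : ℝ, Continuous fun y => C 0 y R := fun R =>
    h.continuous_C.comp (by fun_prop : Continuous fun y : ℝ => ((0 : ℝ), y, R))
  have hb : ∀ R : ℝ, ∃ M : ℝ, ∀ y, |C 0 y R| ≤ M := fun R => by
    obtain ⟨M, hM⟩ := ((h.C_periodic 0 R).isBounded_of_continuous one_ne_zero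
      (hc R)).exists_norm_le
    exact ⟨M, fun y => hM _ ⟨y, rfl⟩⟩
  obtain ⟨M₁, h₁⟩ := hb 1
  obtain ⟨M₂, h₂⟩ := hb (-1)
  refine ⟨max M₁ M₂, fun σ p hp => ?_⟩
  set y := p.2.1
  set R := fiberInv (C σ) y p.2.2 with hR
  have hCR : C σ y R = p.2.2 := apply_fiberInv (h.C_surjective σ y) _
  have hR1 : 1 ≤ |R| := by
    rw [le_abs]
    rcases lt_abs.1 hp with hp | hp
    · left
      rw [← (h.C_strictMono σ y).le_iff_le, hCR, h.C_stable σ y 1 (by simp)]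
      exact (le_abs_self _).trans ((h₁ y).trans ((le_max_left _ _).trans hp.le))
    · right
      rw [le_neg, ← (h.C_strictMono σ y).le_iff_le, hCR,
        h.C_stable σ y (-1) (by simp), ← neg_le_neg_iff]
      exact (neg_le_abs _).trans ((h₂ y).trans ((le_max_right _ _).trans hp.le))
  have hR0 : fiberInv (C 0) y p.2.2 = R :=
    fiberInv_eq (h.C_strictMono 0 y) (by rw [← h.C_stable σ y R hR1, hCR])
  simp only [lift]
  rw [hR0, ← hR, h.A_stable σ y R hR1, h.B_stable σ y R hR1]

theorem tendstoUniformly_homeo :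
    TendstoUniformly (fun σ => (h.homeo σ : Y → Y)) (h.homeo 0) (𝓝 0) := by
  obtain ⟨M, hM⟩ := h.exists_lift_eq
  have hK : IsCompact (univ ×ˢ univ ×ˢ Icc (-M) M : Set Y) :=
    isCompact_univ.prod (isCompact_univ.prod isCompact_Icc)
  intro u hu
  have hcont : Continuous (Function.uncurry fun σ => (h.homeo σ : Y → Y)) :=
    continuous_descend h.isEquivariant_lift h.continuous_lift
  obtain ⟨v, hv, hvu⟩ := hK.mem_uniformity_of_prod (s := univ) (q := (0 : ℝ))
    hcont.continuousOn (mem_univ _) (symm_le_uniformity hu)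
  rw [nhdsWithin_univ] at hv
  filter_upwards [hv] with σ hσ q
  by_cases hq : |q.2.2| ≤ M
  · exact hvu σ hσ q ⟨mem_univ _, mem_univ _, abs_le.1 hq⟩
  · obtain ⟨p, rfl⟩ := isOpenQuotientMap_proj.surjective q
    rw [h.homeo_proj, h.homeo_proj, hM σ p (not_le.1 hq)]
    exact refl_mem_uniformity hu

theorem isContactHomeomorphism_homeo_zero
    (hσ : ∀ σ, 0 < σ → IsContactomorphism (h.homeo σ)) :
    IsContactHomeomorphism (h.homeo 0) := by
  refine ⟨fun n => h.homeo (1 / ((n : ℝ) + 1)), fun n => hσ _ (by positivity), fun u hu => ?_⟩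
  exact (tendsto_one_div_add_atTop_nhds_zero_nat (𝕜 := ℝ)).eventually
    (h.tendstoUniformly_homeo u hu)

/-- If `A = -∂T/∂R`, `B = y + T - R ∂T/∂R` and `C = R / (1 + ∂T/∂y)` for a smooth generating
function `T` of the mixed coordinates, then the pullback of `α` is `W α` with `W = 1 + ∂T/∂y`. The
common factor `D` of `∂B/∂y` and `∂C/∂R = D / W²` ensures that the inverses are smooth. -/
theorem isContactomorphism_homeo {σ : ℝ} {T W D : ℝ → ℝ → ℝ} (hT : ContDiff ℝ ∞ ↿T)
    (hTy : ∀ y R, HasDerivAt (fun y => T y R) (W y R - 1) y)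
    (hTR : ∀ y R, HasDerivAt (T y) (-A σ y R) R)
    (hB : ∀ y R, B σ y R = y + T y R + R * A σ y R)
    (hC : ∀ y R, C σ y R = R / W y R)
    (hBy : ∀ y R, HasDerivAt (fun y => B σ y R) (D y R) y)
    (hCR : ∀ y R, HasDerivAt (C σ y) (D y R / W y R ^ 2) R)
    (hW : ∀ y R, 0 < W y R) (hD : ∀ y R, 0 < D y R) : IsContactomorphism (h.homeo σ) := by
  -- the total differential of `T`
  have hTd : ∀ y R a b : ℝ, fderiv ℝ ↿T (y, R) (a, b) = a * (W y R - 1) - b * A σ y R := by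
    intro y R a b
    have hd := ((hT.differentiable (by simp)) (y, R)).hasFDerivAt
    have h1 : HasDerivAt (fun y : ℝ => (y, R)) ((1 : ℝ), (0 : ℝ)) y :=
      (hasDerivAt_id _).prodMk (hasDerivAt_const _ _)
    have h2 : HasDerivAt (fun R : ℝ => (y, R)) ((0 : ℝ), (1 : ℝ)) R :=
      (hasDerivAt_const _ _).prodMk (hasDerivAt_id _)
    have e1 := (HasFDerivAt.comp_hasDerivAt y (f := fun y : ℝ => (y, R)) hd h1).unique (hTy y R)
    have e2 := (HasFDerivAt.comp_hasDerivAt R (f := fun R : ℝ => (y, R)) hd h2).unique (hTR y R)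
    rw [show ((a, b) : ℝ × ℝ) = a • ((1 : ℝ), (0 : ℝ)) + b • ((0 : ℝ), (1 : ℝ)) by simp, map_add,
      map_smul, map_smul, e1, e2]
    simp only [smul_eq_mul]
    ring
  have hT' : ContDiff ℝ ∞ (fderiv ℝ ↿T) := hT.fderiv_right (by simp)
  have hAs : ContDiff ℝ ∞ ↿(A σ) := by
    have : ↿(A σ) = fun p : ℝ × ℝ => -fderiv ℝ ↿T p (0, 1) := funext fun p => by
      rw [hTd]; simp [Function.HasUncurry.uncurry]
    rw [this]; fun_prop
  have hWs : ContDiff ℝ ∞ ↿W := by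
    have : ↿W = fun p : ℝ × ℝ => 1 + fderiv ℝ ↿T p (1, 0) := funext fun p => by
      rw [hTd]; simp [Function.HasUncurry.uncurry]
    rw [this]; fun_prop
  have hBs : ContDiff ℝ ∞ ↿(B σ) := by
    have : ↿(B σ) = fun p : ℝ × ℝ => p.1 + ↿T p + p.2 * ↿(A σ) p := funext fun p => hB _ _
    rw [this]; fun_prop
  have hCs : ContDiff ℝ ∞ ↿(C σ) := by
    have : ↿(C σ) = fun p : ℝ × ℝ => p.2 / ↿W p := funext fun p => hC _ _
    rw [this]; exact contDiff_snd.div hWs fun p => (hW _ _).ne'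
  have hρ : ContDiff ℝ ∞ ↿(fiberInv (C σ)) :=
    contDiff_fiberInv hCs hCR (fun y R => div_pos (hD y R) (pow_pos (hW y R) 2))
      (h.C_surjective σ)
  have hβ : ContDiff ℝ ∞ ↿(fiberInv fun R y => B σ y R) :=
    contDiff_fiberInv (c' := fun R y => D y R)
      (hBs.comp (by fun_prop : ContDiff ℝ ∞ fun p : ℝ × ℝ => (p.2, p.1)))
      (fun R y => hBy y R) (fun R y => hD y R) (h.B_surjective σ)
  have hρ' : ContDiff ℝ ∞ fun p : Cover => fiberInv (C σ) p.2.1 p.2.2 :=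
    hρ.comp (by fun_prop : ContDiff ℝ ∞ fun p : Cover => (p.2.1, p.2.2))
  have hβ' : ContDiff ℝ ∞ fun p : Cover => fiberInv (fun R y => B σ y R) p.2.2 p.2.1 :=
    hβ.comp (by fun_prop : ContDiff ℝ ∞ fun p : Cover => (p.2.2, p.2.1))
  refine ⟨lift A B C σ, invLift A B C σ, ⟨?_, fun p => (h.homeo_proj σ p).symm⟩,
    ⟨?_, fun p => (h.homeo_symm_proj σ p).symm⟩, fun p v => ?_⟩
  · have hp : ContDiff ℝ ∞ fun p : Cover => (p.2.1, fiberInv (C σ) p.2.1 p.2.2) := by fun_prop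
    exact (contDiff_fst.add (hAs.comp hp)).prodMk ((hBs.comp hp).prodMk hρ')
  · have hp : ContDiff ℝ ∞ fun p : Cover => (fiberInv (fun R y => B σ y R) p.2.2 p.2.1, p.2.2) := by
      fun_prop
    exact (contDiff_fst.sub (hAs.comp hp)).prodMk (hβ'.prodMk (hCs.comp hp))
  · set ρ : Cover → ℝ := fun p => fiberInv (C σ) p.2.1 p.2.2 with hρdef
    have hρd := ((hρ'.differentiable (by simp)) p).hasFDerivAt
    set ρ' := fderiv ℝ ρ p
    have hyd : HasFDerivAt (fun p : Cover => p.2.1)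
      (ContinuousLinearMap.fst ℝ ℝ ℝ ∘L ContinuousLinearMap.snd ℝ ℝ (ℝ × ℝ)) p :=
      (ContinuousLinearMap.fst ℝ ℝ ℝ ∘L ContinuousLinearMap.snd ℝ ℝ (ℝ × ℝ)).hasFDerivAt
    have hpd : HasFDerivAt (fun p : Cover => (p.2.1, ρ p)) _ p := hyd.prodMk hρd
    have hTp := HasFDerivAt.comp p (g := ↿T) (f := fun p : Cover => (p.2.1, ρ p))
      ((hT.differentiable (by simp)) (p.2.1, ρ p)).hasFDerivAt hpd
    have hAp := HasFDerivAt.comp p (g := ↿(A σ)) (f := fun p : Cover => (p.2.1, ρ p))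
      ((hAs.differentiable (by simp)) (p.2.1, ρ p)).hasFDerivAt hpd
    have hlift : lift A B C σ = fun p : Cover => (p.1 + (↿(A σ) ∘ fun p : Cover => (p.2.1, ρ p)) p,
        p.2.1 + (↿T ∘ fun p : Cover => (p.2.1, ρ p)) p +
          ρ p * (↿(A σ) ∘ fun p : Cover => (p.2.1, ρ p)) p, ρ p) := by
      funext p
      simp only [lift, hB, hρdef, Function.HasUncurry.uncurry, Function.comp, id]
    have hF := (hasFDerivAt_fst.add hAp).prodMk
      (((hyd.add hTp).add (hρd.mul hAp)).prodMk hρd)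
    have hr : p.2.2 = ρ p / W p.2.1 (ρ p) := by
      rw [← hC, hρdef, apply_fiberInv (h.C_surjective σ p.2.1)]
    have hWp := hW p.2.1 (ρ p)
    rw [contactForm_apply, contactForm_apply, hlift]
    have key : ∀ z w : ℝ, z = W p.2.1 (ρ p) * w → (z = 0 ↔ w = 0) := by
      rintro z w rfl
      simp [hWp.ne']
    apply key
    have hFd := hF.fderiv
    simp only [Pi.add_def, Pi.mul_def] at hFd
    have hTd' := hTd p.2.1 (ρ p) v.2.1 (ρ' v)
    rw [hFd]
    simp only [ContinuousLinearMap.prod_apply, add_apply,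
      ContinuousLinearMap.comp_apply, ContinuousLinearMap.coe_fst', ContinuousLinearMap.coe_snd',
      smul_apply, smul_eq_mul, hTd']
    rw [hr]
    field_simp
    simp only [Function.comp, Function.HasUncurry.uncurry, id]
    ring

end MixedFamily

/-! ### The slow step and the smoothing scale -/

/-- A smooth monotone step from `0` to `1`, equal to `1` on `[0, ∞)`, whose second derivative is
bounded below by `-μ` times the step itself. -/
structure IsSlowStep (μ : ℝ) (S : ℝ → ℝ) : Prop where
  contDiff : ContDiff ℝ ∞ S
  eq_one : ∀ x, 0 ≤ x → S x = 1
  eq_zero : ∃ L : ℝ, 0 < L ∧ ∀ x ≤ -L, S x = 0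
  nonneg : ∀ x, 0 ≤ S x
  deriv_nonneg : ∀ x, 0 ≤ deriv S x
  le_deriv_deriv : ∀ x, -(μ * S x) ≤ deriv (deriv S) x

theorem expNegInvGlue_le_one (x : ℝ) : expNegInvGlue x ≤ 1 := by
  unfold expNegInvGlue
  split_ifs with h
  · exact zero_le_one
  · rw [Real.exp_le_one_iff, neg_nonpos, inv_nonneg]
    linarith

theorem deriv_deriv_expNegInvGlue_nonneg {x : ℝ} (hx : x ≤ 1 / 2) :
    0 ≤ deriv (deriv expNegInvGlue) x := by
  have h1 : ∀ y, HasDerivAt expNegInvGlue (y⁻¹ ^ 2 * expNegInvGlue y) y := fun y => by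
    simpa using expNegInvGlue.hasDerivAt_polynomial_eval_inv_mul 1 y
  have h2 : HasDerivAt (fun y : ℝ => y⁻¹ ^ 2 * expNegInvGlue y)
      (x⁻¹ ^ 2 * (x⁻¹ ^ 2 - 2 * x⁻¹) * expNegInvGlue x) x := by
    have := expNegInvGlue.hasDerivAt_polynomial_eval_inv_mul (Polynomial.X ^ 2) x
    simpa only [Polynomial.eval_pow, Polynomial.eval_X, Polynomial.eval_mul, Polynomial.eval_sub,
      Polynomial.derivative_X_pow, Polynomial.eval_C, Nat.cast_ofNat, pow_one,
      Nat.add_one_sub_one] using this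
  rw [show deriv expNegInvGlue = _ from funext fun y => (h1 y).deriv, h2.deriv]
  rcases le_or_gt x 0 with h | h
  · rw [expNegInvGlue.zero_of_nonpos h, mul_zero]
  · have : 2 ≤ x⁻¹ := by rw [le_inv_comm₀ two_pos h]; simpa using hx
    exact mul_nonneg (mul_nonneg (by positivity) (by nlinarith)) (expNegInvGlue.nonneg x)

open Real in
/-- Near its zeros the step is `exp (-1/x)`, which is convex there; elsewhere it is bounded below.
A stretch of the variable then makes the second derivative as small as desired. -/
theorem exists_isSlowStep {μ : ℝ} (hμ : 0 < μ) : ∃ S, IsSlowStep μ S := by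
  set S₀ : ℝ → ℝ := fun x => 1 - (1 - expNegInvGlue x) * (1 - smoothTransition (x - 1)) with hS₀
  have hE : ContDiff ℝ ∞ expNegInvGlue := expNegInvGlue.contDiff
  have hst : ContDiff ℝ ∞ smoothTransition := smoothTransition.contDiff
  have hs : ContDiff ℝ ∞ S₀ := by fun_prop
  have h1 : ∀ x, 2 ≤ x → S₀ x = 1 := fun x hx => by
    simp only [hS₀, smoothTransition.one_of_one_le (show 1 ≤ x - 1 by linarith)]; ring
  have hsmall : ∀ x ≤ 1, S₀ x = expNegInvGlue x := fun x hx => by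
    simp only [hS₀, smoothTransition.zero_of_nonpos (show x - 1 ≤ 0 by linarith)]; ring
  have hmono : Monotone S₀ := fun x y hxy => by
    have e1 := expNegInvGlue.monotone hxy
    have e2 := smoothTransition.monotone (sub_le_sub_right hxy 1)
    have e3 := expNegInvGlue_le_one y
    have e4 := smoothTransition.le_one (x - 1)
    simp only [hS₀]
    nlinarith
  have hpos : ∀ x, 0 ≤ S₀ x := fun x => by
    rcases le_total x 1 with h | h
    · rw [hsmall x h]; exact expNegInvGlue.nonneg x
    · refine le_trans ?_ (hmono h)
      rw [hsmall 1 le_rfl]; exact expNegInvGlue.nonneg 1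
  have hs' : ContDiff ℝ ∞ (deriv S₀) := ((contDiff_infty_iff_deriv).1 hs).2
  have hs'' : ContDiff ℝ ∞ (deriv (deriv S₀)) := ((contDiff_infty_iff_deriv).1 hs').2
  obtain ⟨M, hM⟩ := (isCompact_Icc (a := (1 / 2 : ℝ)) (b := 2)).exists_bound_of_continuousOn
    hs''.continuous.continuousOn
  have hM0 : 0 ≤ M := (norm_nonneg _).trans (hM 1 (by norm_num))
  set c := expNegInvGlue (1 / 2) with hc
  have hc0 : 0 < c := expNegInvGlue.pos_of_pos (by norm_num)
  have hbound : ∀ x, -(M / c * S₀ x) ≤ deriv (deriv S₀) x := by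
    intro x
    have hr : 0 ≤ M / c * S₀ x := mul_nonneg (div_nonneg hM0 hc0.le) (hpos x)
    rcases le_or_gt x (1 / 2) with h | h
    · have hev : S₀ =ᶠ[𝓝 x] expNegInvGlue := by
        filter_upwards [Iio_mem_nhds (show x < 1 by linarith)] with y hy using hsmall y hy.le
      rw [hev.deriv.deriv_eq]
      linarith [deriv_deriv_expNegInvGlue_nonneg h]
    · rcases le_or_gt x 2 with h' | h'
      · have e1 := (abs_le.1 (hM x ⟨h.le, h'⟩)).1
        have e2 : c ≤ S₀ x := by
          have := hmono h.le
          rwa [hsmall _ (by norm_num)] at this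
        have e3 : M / c * c ≤ M / c * S₀ x :=
          mul_le_mul_of_nonneg_left e2 (div_nonneg hM0 hc0.le)
        rw [div_mul_cancel₀ _ hc0.ne'] at e3
        linarith
      · have hev : S₀ =ᶠ[𝓝 x] fun _ => 1 := by
          filter_upwards [Ioi_mem_nhds h'] with y hy using h1 y hy.le
        rw [hev.deriv.deriv_eq]
        simpa using hr
  -- stretch by `κ` with `κ ^ 2 * (M / c) ≤ μ`
  obtain ⟨κ, hκ, hκμ⟩ : ∃ κ : ℝ, 0 < κ ∧ κ ^ 2 * (M / c) ≤ μ := by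
    have hq : 0 ≤ M / c := div_nonneg hM0 hc0.le
    refine ⟨√(μ / (M / c + 1)), by positivity, ?_⟩
    rw [Real.sq_sqrt (by positivity), div_mul_eq_mul_div, div_le_iff₀ (by positivity)]
    nlinarith
  have hlin : ∀ x : ℝ, HasDerivAt (fun x : ℝ => 2 + κ * x) κ x := fun x => by
    simpa using ((hasDerivAt_id x).const_mul κ).const_add 2
  have hd1 : ∀ x, HasDerivAt (fun x => S₀ (2 + κ * x)) (deriv S₀ (2 + κ * x) * κ) x := fun x =>
    ((hs.differentiable (by simp)) _).hasDerivAt.comp x (hlin x)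
  have hd2 : ∀ x, HasDerivAt (fun x => deriv S₀ (2 + κ * x) * κ)
      (deriv (deriv S₀) (2 + κ * x) * κ * κ) x := fun x =>
    (((hs'.differentiable (by simp)) _).hasDerivAt.comp x (hlin x)).mul_const κ
  refine ⟨fun x => S₀ (2 + κ * x), by fun_prop, fun x hx => h1 _ ?_, ⟨2 / κ, by positivity,
    fun x hx => ?_⟩, fun x => hpos _, fun x => ?_, fun x => ?_⟩
  · have := mul_nonneg hκ.le hx; linarith
  · have : 2 + κ * x ≤ 0 := by
      have := mul_le_mul_of_nonneg_left hx hκ.le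
      rw [mul_neg, mul_div_cancel₀ _ hκ.ne'] at this
      linarith
    rw [hsmall _ (by linarith), expNegInvGlue.zero_of_nonpos this]
  · rw [(hd1 x).deriv]
    exact mul_nonneg hmono.deriv_nonneg hκ.le
  · rw [show deriv (fun x => S₀ (2 + κ * x)) = _ from funext fun y => (hd1 y).deriv, (hd2 x).deriv]
    have e1 := mul_le_mul_of_nonneg_left (hbound (2 + κ * x)) (sq_nonneg κ)
    have e2 := mul_le_mul_of_nonneg_right hκμ (hpos (2 + κ * x))
    nlinarith

/-- A family of smoothing scales: `m σ R` vanishes only at `σ = R = 0`, is quadratic in `R` when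
`σ = 0`, grows in `|R|` at most like `|R| ^ (2K)` and is independent of `σ` for `1 ≤ |R|`. -/
structure IsScale (K m₀ : ℝ) (m : ℝ → ℝ → ℝ) : Prop where
  contDiff : ContDiff ℝ ∞ ↿m
  pos : ∀ σ R, σ ≠ 0 ∨ R ≠ 0 → 0 < m σ R
  zero : m 0 0 = 0
  le : ∀ σ R, m σ R ≤ m₀
  le_sq : ∀ R, m 0 R ≤ m₀ * K * R ^ 2
  eq_of_one_le : ∀ σ R, 1 ≤ |R| → m σ R = m₀
  deriv_nonneg : ∀ σ R, 0 ≤ R * deriv (m σ) R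
  deriv_le : ∀ σ R, R * deriv (m σ) R ≤ 2 * K * m σ R
  abs_deriv_le : ∀ σ R, |deriv (m σ) R| ≤ m₀ * (2 * K) * |R|

open Real in
/-- The scale is obtained from `ζ R = R² + (1 - R²) st (R²)`, with `st` the smooth transition. -/
theorem exists_isScale : ∃ K : ℝ, 0 < K ∧ ∀ m₀ : ℝ, 0 < m₀ → ∃ m, IsScale K m₀ m := by
  have hst : ContDiff ℝ ∞ smoothTransition := smoothTransition.contDiff
  have hst' : ContDiff ℝ ∞ (deriv smoothTransition) := ((contDiff_infty_iff_deriv).1 hst).2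
  have hstd : ∀ z, HasDerivAt smoothTransition (deriv smoothTransition z) z := fun z =>
    ((hst.differentiable (by simp)) z).hasDerivAt
  obtain ⟨M, hM⟩ := (isCompact_Icc (a := (0 : ℝ)) (b := 1)).exists_bound_of_continuousOn
    hst'.continuous.continuousOn
  have hM0 : 0 ≤ M := (norm_nonneg _).trans (hM 0 (by norm_num))
  have hst0 : ∀ z, 0 ≤ deriv smoothTransition z := fun z => smoothTransition.monotone.deriv_nonneg
  have hstM : ∀ z, 0 ≤ z → z ≤ 1 → smoothTransition z ≤ M * z := fun z hz hz1 => by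
    have := (convex_Icc (0 : ℝ) 1).norm_image_sub_le_of_norm_deriv_le
      (fun x _ => (hstd x).differentiableAt) hM (left_mem_Icc.2 zero_le_one) ⟨hz, hz1⟩
    rw [smoothTransition.zero, sub_zero, sub_zero, Real.norm_of_nonneg hz] at this
    exact (le_abs_self _).trans this
  set ζ : ℝ → ℝ := fun R => R ^ 2 + (1 - R ^ 2) * smoothTransition (R ^ 2) with hζ
  have hζs : ContDiff ℝ ∞ ζ := by fun_prop
  have hζ1 : ∀ R : ℝ, 1 ≤ R ^ 2 → ζ R = 1 := fun R hR => by
    simp only [hζ, smoothTransition.one_of_one_le hR]; ring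
  have hζle : ∀ R : ℝ, ζ R ≤ 1 := fun R => by
    rcases le_total (R ^ 2) 1 with h | h
    · have := smoothTransition.le_one (R ^ 2)
      simp only [hζ]; nlinarith
    · exact (hζ1 R h).le
  have hζge : ∀ R : ℝ, R ^ 2 ≤ 1 → R ^ 2 ≤ ζ R := fun R h => by
    have := smoothTransition.nonneg (R ^ 2)
    simp only [hζ]; nlinarith
  have hζ0 : ∀ R : ℝ, 0 ≤ ζ R := fun R => by
    rcases le_total (R ^ 2) 1 with h | h
    · exact (sq_nonneg R).trans (hζge R h)
    · rw [hζ1 R h]; exact zero_le_one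
  have hζpos : ∀ R : ℝ, R ≠ 0 → 0 < ζ R := fun R hR => by
    rcases le_total (R ^ 2) 1 with h | h
    · exact lt_of_lt_of_le (by positivity) (hζge R h)
    · rw [hζ1 R h]; exact zero_lt_one
  have hζsq : ∀ R : ℝ, ζ R ≤ (1 + M) * R ^ 2 := fun R => by
    rcases le_total (R ^ 2) 1 with h | h
    · have e1 := hstM (R ^ 2) (sq_nonneg R) h
      have e2 := smoothTransition.nonneg (R ^ 2)
      simp only [hζ]; nlinarith [sq_nonneg R, mul_nonneg (sq_nonneg R) e2]
    · rw [hζ1 R h]; nlinarith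
  -- the derivative is `2 R` times a factor between `0` and `1 + M`
  obtain ⟨q, hq0, hqM, hq1, hζd⟩ : ∃ q : ℝ → ℝ, (∀ R, 0 ≤ q R) ∧ (∀ R, q R ≤ 1 + M) ∧
      (∀ R, 1 < R ^ 2 → q R = 0) ∧ ∀ R, HasDerivAt ζ (2 * R * q R) R := by
    have hd : ∀ R, HasDerivAt ζ (2 * R * (1 - smoothTransition (R ^ 2) +
        (1 - R ^ 2) * deriv smoothTransition (R ^ 2))) R := fun R => by
      have h2 : HasDerivAt (fun R : ℝ => R ^ 2) (2 * R) R := by simpa using hasDerivAt_pow 2 R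
      have e := h2.fun_add ((h2.const_sub 1).fun_mul ((hstd (R ^ 2)).comp R h2))
      exact e.congr_deriv (by simp only [Function.comp]; ring)
    have hz : ∀ R : ℝ, 1 < R ^ 2 → deriv smoothTransition (R ^ 2) = 0 := fun R hR => by
      have : smoothTransition =ᶠ[𝓝 (R ^ 2)] fun _ => 1 := by
        filter_upwards [Ioi_mem_nhds hR] with z hz using smoothTransition.one_of_one_le hz.le
      rw [this.deriv_eq]; simp
    have hz1 : ∀ R : ℝ, 1 < R ^ 2 → 1 - smoothTransition (R ^ 2) +
        (1 - R ^ 2) * deriv smoothTransition (R ^ 2) = 0 := fun R hR => by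
      rw [hz R hR, smoothTransition.one_of_one_le hR.le]; ring
    refine ⟨_, fun R => ?_, fun R => ?_, hz1, hd⟩
    · rcases le_or_gt (R ^ 2) 1 with h | h
      · have e1 := smoothTransition.le_one (R ^ 2)
        have e2 := mul_nonneg (sub_nonneg.2 h) (hst0 (R ^ 2))
        linarith
      · rw [hz1 R h]
    · rcases le_or_gt (R ^ 2) 1 with h | h
      · have e1 := smoothTransition.nonneg (R ^ 2)
        have e2 := (le_abs_self _).trans (hM (R ^ 2) ⟨sq_nonneg R, h⟩)
        have e3 := hst0 (R ^ 2)
        nlinarith [sq_nonneg R]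
      · rw [hz1 R h]; linarith
  refine ⟨1 + M, by linarith, fun m₀ hm₀ => ?_⟩
  set w : ℝ → ℝ := fun σ => σ ^ 2 / (1 + σ ^ 2) with hw
  have hw0 : ∀ σ, 0 ≤ w σ := fun σ => by positivity
  have hw1 : ∀ σ, 0 < 1 - w σ := fun σ => by
    have : 0 < 1 + σ ^ 2 := by positivity
    rw [sub_pos, hw, div_lt_one this]; linarith
  have hws : ContDiff ℝ ∞ w :=
    ContDiff.div (by fun_prop) (by fun_prop) fun σ => by positivity
  set m : ℝ → ℝ → ℝ := fun σ R => m₀ * (w σ + (1 - w σ) * ζ R) with hm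
  have hmd : ∀ σ R, deriv (m σ) R = m₀ * ((1 - w σ) * (2 * R * q R)) := fun σ R =>
    ((((hζd R).const_mul (1 - w σ)).const_add (w σ)).const_mul m₀).deriv
  refine ⟨m, ?_, ?_, ?_, ?_, ?_, ?_, ?_, ?_, ?_⟩
  · have e1 : ContDiff ℝ ∞ fun p : ℝ × ℝ => w p.1 := hws.comp contDiff_fst
    have e2 : ContDiff ℝ ∞ fun p : ℝ × ℝ => ζ p.2 := hζs.comp contDiff_snd
    exact contDiff_const.mul (e1.add ((contDiff_const.sub e1).mul e2))
  · intro σ R h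
    refine mul_pos hm₀ ?_
    by_cases hR : R = 0
    · have : 0 < w σ := by have := h.resolve_right (by simpa using hR); positivity
      have := mul_nonneg (hw1 σ).le (hζ0 R)
      linarith
    · have := mul_pos (hw1 σ) (hζpos R hR)
      have := hw0 σ
      linarith
  · simp [hm, hw, hζ]
  · intro σ R
    have := mul_le_mul_of_nonneg_left (hζle R) (hw1 σ).le
    simp only [hm]
    nlinarith
  · intro R
    have := mul_le_mul_of_nonneg_left (hζsq R) hm₀.le
    simp only [hm, hw]
    simp
    linarith
  · intro σ R hR
    simp only [hm, hζ1 R ((one_le_sq_iff_one_le_abs R).2 hR)]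
    ring
  · intro σ R
    rw [hmd]
    have := mul_nonneg (mul_nonneg hm₀.le (hw1 σ).le) (mul_nonneg (sq_nonneg R) (hq0 R))
    nlinarith
  · intro σ R
    rw [hmd]
    have e1 : R ^ 2 * q R ≤ (1 + M) * ζ R := by
      rcases le_or_gt (R ^ 2) 1 with h | h
      · calc R ^ 2 * q R ≤ ζ R * (1 + M) :=
            mul_le_mul (hζge R h) (hqM R) (hq0 R) (hζ0 R)
          _ = _ := mul_comm _ _
      · rw [hq1 R h, mul_zero]; exact mul_nonneg (by linarith) (hζ0 R)
    have e2 := mul_le_mul_of_nonneg_left e1 (mul_nonneg hm₀.le (hw1 σ).le)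
    have e3 : 0 ≤ m₀ * (1 + M) * w σ :=
      mul_nonneg (mul_nonneg hm₀.le (by linarith)) (hw0 σ)
    simp only [hm]
    nlinarith
  · intro σ R
    rw [hmd, abs_mul, abs_mul, abs_mul, abs_mul, abs_of_pos hm₀, abs_of_pos (hw1 σ),
      abs_of_nonneg (hq0 R), abs_of_pos (two_pos (α := ℝ))]
    have e1 : (1 - w σ) * q R ≤ 1 * (1 + M) :=
      mul_le_mul (by linarith [hw0 σ]) (hqM R) (hq0 R) zero_le_one
    have := mul_le_mul_of_nonneg_left e1 (show 0 ≤ m₀ * 2 * |R| by positivity)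
    linarith

/-! ### Profiles and their cutoffs at small values -/

/-- The homeomorphism `h` of the line is the identity away from `(-ε, ε)`, is smooth away from `0`
with derivative `h'`, and expands by at least `2θ`. The value of `h'` at `0`, where `h` need not be
differentiable, is set to `θ`. -/
structure IsProfile (ε θ : ℝ) (h h' : ℝ → ℝ) : Prop where
  pos : 0 < θ
  eq_self : ∀ y, ε ≤ |y| → h y = y
  zero : h 0 = 0
  continuous : Continuous h
  contDiffAt : ∀ y, y ≠ 0 → ContDiffAt ℝ ∞ h y
  hasDerivAt : ∀ y, y ≠ 0 → HasDerivAt h (h' y) y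
  deriv_zero : h' 0 = θ
  le_deriv : ∀ y, y ≠ 0 → 2 * θ ≤ h' y

namespace IsProfile
variable {ε θ : ℝ} {h h' : ℝ → ℝ}

theorem continuousAt_deriv (hh : IsProfile ε θ h h') {y : ℝ} (hy : y ≠ 0) :
    ContinuousAt h' y := by
  have h1 : ContinuousAt (fun y => fderiv ℝ h y 1) y :=
    ((hh.contDiffAt y hy).continuousAt_fderiv (by simp)).clm_apply continuousAt_const
  refine h1.congr ?_
  filter_upwards [isOpen_ne.mem_nhds hy] with z hz
  exact (hh.hasDerivAt z hz).deriv

theorem mul_le_apply (hh : IsProfile ε θ h h') {y : ℝ} (hy : 0 ≤ y) : 2 * θ * y ≤ h y := by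
  have hm : MonotoneOn (fun y => h y - 2 * θ * y) (Ici 0) := by
    refine monotoneOn_of_hasDerivWithinAt_nonneg (f' := fun y => h' y - 2 * θ) (convex_Ici 0)
      (hh.continuous.sub (by fun_prop)).continuousOn (fun y hy => ?_) fun y hy => ?_
    all_goals rw [interior_Ici] at hy
    · have := ((hasDerivAt_id y).const_mul (2 * θ))
      simp only [mul_one] at this
      exact ((hh.hasDerivAt y hy.ne').fun_sub this).hasDerivWithinAt
    · exact sub_nonneg.2 (hh.le_deriv y hy.ne')
  have := hm self_mem_Ici hy hy
  simp only [hh.zero] at this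
  linarith

theorem apply_le_mul (hh : IsProfile ε θ h h') {y : ℝ} (hy : y ≤ 0) : h y ≤ 2 * θ * y := by
  have hm : MonotoneOn (fun y => h y - 2 * θ * y) (Iic 0) := by
    refine monotoneOn_of_hasDerivWithinAt_nonneg (f' := fun y => h' y - 2 * θ) (convex_Iic 0)
      (hh.continuous.sub (by fun_prop)).continuousOn (fun y hy => ?_) fun y hy => ?_
    all_goals rw [interior_Iic] at hy
    · have := ((hasDerivAt_id y).const_mul (2 * θ))
      simp only [mul_one] at this
      exact ((hh.hasDerivAt y hy.ne).fun_sub this).hasDerivWithinAt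
    · exact sub_nonneg.2 (hh.le_deriv y hy.ne)
  have := hm hy self_mem_Iic hy
  simp only [hh.zero] at this
  linarith

theorem ne_zero (hh : IsProfile ε θ h h') {y : ℝ} (hy : y ≠ 0) : h y ≠ 0 := by
  have := hh.pos
  rcases lt_or_gt_of_ne hy with h1 | h1
  · have := hh.apply_le_mul h1.le
    have : 2 * θ * y < 0 := by nlinarith
    linarith
  · have := hh.mul_le_apply h1.le
    have : 0 < 2 * θ * y := by positivity
    linarith

theorem strictMono (hh : IsProfile ε θ h h') : StrictMono h := by
  have hp := hh.pos
  refine StrictMonoOn.Iic_union_Ici (a := 0) ?_ ?_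
  · refine strictMonoOn_of_deriv_pos (convex_Iic 0) hh.continuous.continuousOn fun y hy => ?_
    rw [interior_Iic] at hy
    rw [(hh.hasDerivAt y hy.ne).deriv]
    linarith [hh.le_deriv y hy.ne]
  · refine strictMonoOn_of_deriv_pos (convex_Ici 0) hh.continuous.continuousOn fun y hy => ?_
    rw [interior_Ici] at hy
    rw [(hh.hasDerivAt y hy.ne').deriv]
    linarith [hh.le_deriv y hy.ne']

/-- The ratio `(h y - θ y) / h y` lies between `1/2` and `1`. -/
theorem ratio_mem (hh : IsProfile ε θ h h') {y : ℝ} (hy : y ≠ 0) :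
    (h y - θ * y) / h y ∈ Icc (1 / 2 : ℝ) 1 := by
  have hp := hh.pos
  rcases lt_or_gt_of_ne hy with h1 | h1
  · have h2 := hh.apply_le_mul h1.le
    have h3 : θ * y < 0 := by nlinarith
    have h4 : h y < 0 := by linarith
    constructor
    · rw [le_div_iff_of_neg h4]; linarith
    · rw [div_le_iff_of_neg h4]; linarith
  · have h2 := hh.mul_le_apply h1.le
    have h3 : 0 < θ * y := by positivity
    have h4 : 0 < h y := by linarith
    constructor
    · rw [le_div_iff₀ h4]; linarith
    · rw [div_le_iff₀ h4]; linarith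

theorem abs_sub_le (hh : IsProfile ε θ h h') (y : ℝ) : |h y - θ * y| ≤ |h y| := by
  rcases eq_or_ne y 0 with rfl | hy
  · simp [hh.zero]
  · have h1 := hh.ratio_mem hy
    have h2 : |(h y - θ * y) / h y| ≤ 1 := abs_le.2 ⟨by linarith [h1.1], h1.2⟩
    rwa [abs_div, div_le_one (abs_pos.2 (hh.ne_zero hy))] at h2

end IsProfile

/-- A smooth function which vanishes on `(-∞, -L]` and is constant on `[0, ∞)`. -/
structure IsCutoff (L : ℝ) (P : ℝ → ℝ) : Prop where
  contDiff : ContDiff ℝ ∞ P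
  eq_zero : ∀ x ≤ -L, P x = 0
  eq_apply_zero : ∀ x, 0 ≤ x → P x = P 0

namespace IsCutoff
variable {L : ℝ} {P Q : ℝ → ℝ}

theorem hasDerivAt (hP : IsCutoff L P) (x : ℝ) : HasDerivAt P (deriv P x) x :=
  ((hP.contDiff.differentiable (by simp)) x).hasDerivAt

theorem deriv_eq_zero_of_nonneg (hP : IsCutoff L P) {x : ℝ} (hx : 0 ≤ x) : deriv P x = 0 := by
  have h1 : HasDerivWithinAt P 0 (Ici x) x :=
    (hasDerivWithinAt_const x (Ici x) (P 0)).congr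
      (fun z hz => hP.eq_apply_zero z (hx.trans hz)) (hP.eq_apply_zero x hx)
  exact (uniqueDiffWithinAt_Ici x).eq_deriv _ (hP.hasDerivAt x).hasDerivWithinAt h1

theorem deriv_eq_zero_of_le (hP : IsCutoff L P) {x : ℝ} (hx : x ≤ -L) : deriv P x = 0 := by
  have h1 : HasDerivWithinAt P 0 (Iic x) x :=
    (hasDerivWithinAt_const x (Iic x) (0 : ℝ)).congr
      (fun z hz => hP.eq_zero z (le_trans hz hx)) (hP.eq_zero x hx)
  exact (uniqueDiffWithinAt_Iic x).eq_deriv _ (hP.hasDerivAt x).hasDerivWithinAt h1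

theorem deriv (hP : IsCutoff L P) : IsCutoff L (deriv P) where
  contDiff := ((contDiff_infty_iff_deriv).1 hP.contDiff).2
  eq_zero _ hx := hP.deriv_eq_zero_of_le hx
  eq_apply_zero _ hx := by
    rw [hP.deriv_eq_zero_of_nonneg hx, hP.deriv_eq_zero_of_nonneg le_rfl]

theorem add_mul (hP : IsCutoff L P) (hQ : IsCutoff L Q) (b : ℝ) :
    IsCutoff L fun x => P x + b * Q x where
  contDiff := hP.contDiff.add (contDiff_const.mul hQ.contDiff)
  eq_zero x hx := by rw [hP.eq_zero x hx, hQ.eq_zero x hx, mul_zero, add_zero]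
  eq_apply_zero x hx := by rw [hP.eq_apply_zero x hx, hQ.eq_apply_zero x hx]

end IsCutoff

/-- The function `h y - θ y` cut off where `h y` is small compared with the scale `m σ R`. At
`m σ R = 0` the convention `log 0 = 0` gives the value `P 0`, as for large ratios `h y / m σ R`. -/
noncomputable def cut (h : ℝ → ℝ) (θ : ℝ) (m : ℝ → ℝ → ℝ) (P : ℝ → ℝ) (σ y R : ℝ) : ℝ :=
  (h y - θ * y) * P (Real.log (h y / m σ R))

/-- The partial derivative of `cut` in the variable `y`. -/
noncomputable def cutDeriv (h h' : ℝ → ℝ) (θ : ℝ) (m : ℝ → ℝ → ℝ) (P : ℝ → ℝ) (σ y R : ℝ) : ℝ :=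
  (h' y - θ) * P (Real.log (h y / m σ R)) +
    (h y - θ * y) / h y * h' y * deriv P (Real.log (h y / m σ R))

section cut
variable {ε θ L K m₀ : ℝ} {h h' P Q : ℝ → ℝ} {m : ℝ → ℝ → ℝ}

theorem cut_add_mul (b σ y R : ℝ) : cut h θ m (fun x => P x + b * Q x) σ y R =
    cut h θ m P σ y R + b * cut h θ m Q σ y R := by
  simp only [cut]; ring

theorem cutDeriv_add_mul (hP : IsCutoff L P) (hQ : IsCutoff L Q) (b σ y R : ℝ) :
    cutDeriv h h' θ m (fun x => P x + b * Q x) σ y R =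
      cutDeriv h h' θ m P σ y R + b * cutDeriv h h' θ m Q σ y R := by
  have : ∀ x, deriv (fun x => P x + b * Q x) x = deriv P x + b * deriv Q x := fun x =>
    ((hP.hasDerivAt x).fun_add ((hQ.hasDerivAt x).const_mul b)).deriv
  simp only [cutDeriv, this]; ring

theorem log_div_le_of_abs_lt {a b : ℝ} (ha : a ≠ 0) (hb : 0 < b) (hab : |a| < Real.exp (-L) * b) :
    Real.log (a / b) ≤ -L := by
  rw [← Real.log_abs, abs_div, abs_of_pos hb]
  refine (Real.log_le_iff_le_exp (div_pos (abs_pos.2 ha) hb)).2 ?_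
  rw [div_le_iff₀ hb]
  exact hab.le

theorem log_div_nonneg_of_le_abs {a b : ℝ} (hb : 0 ≤ b) (hab : b ≤ |a|) : 0 ≤ Real.log (a / b) := by
  rcases hb.eq_or_lt with rfl | hb'
  · simp
  · rw [← Real.log_abs, abs_div, abs_of_pos hb']
    exact Real.log_nonneg (by rwa [le_div_iff₀ hb', one_mul])

theorem cut_eq_zero (hh : IsProfile ε θ h h') (hP : IsCutoff L P) {σ y R : ℝ} (hm : 0 < m σ R)
    (hlow : |h y| < Real.exp (-L) * m σ R) : cut h θ m P σ y R = 0 := by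
  rcases eq_or_ne y 0 with rfl | hy
  · simp [cut, hh.zero]
  · rw [cut, hP.eq_zero _ (log_div_le_of_abs_lt (hh.ne_zero hy) hm hlow), mul_zero]

theorem cutDeriv_eq_zero (hh : IsProfile ε θ h h') (hP : IsCutoff L P) {σ y R : ℝ}
    (hm : 0 < m σ R) (hlow : |h y| < Real.exp (-L) * m σ R) :
    cutDeriv h h' θ m P σ y R = 0 := by
  rcases eq_or_ne y 0 with rfl | hy
  · simp [cutDeriv, hh.zero, hh.deriv_zero]
  · have := log_div_le_of_abs_lt (hh.ne_zero hy) hm hlow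
    rw [cutDeriv, hP.eq_zero _ this, hP.deriv_eq_zero_of_le this, mul_zero, mul_zero, add_zero]

theorem cut_eq_of_le (hP : IsCutoff L P) {σ y R : ℝ} (hm : 0 ≤ m σ R) (hhigh : m σ R ≤ |h y|) :
    cut h θ m P σ y R = (h y - θ * y) * P 0 := by
  rw [cut, hP.eq_apply_zero _ (log_div_nonneg_of_le_abs hm hhigh)]

theorem cutDeriv_eq_of_le (hP : IsCutoff L P) {σ y R : ℝ} (hm : 0 ≤ m σ R)
    (hhigh : m σ R ≤ |h y|) : cutDeriv h h' θ m P σ y R = (h' y - θ) * P 0 := by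
  have := log_div_nonneg_of_le_abs hm hhigh
  rw [cutDeriv, hP.eq_apply_zero _ this, hP.deriv_eq_zero_of_nonneg this, mul_zero, add_zero]

theorem hasDerivAt_cut_y (hh : IsProfile ε θ h h') (hP : IsCutoff L P) {σ R : ℝ}
    (hm : 0 < m σ R) (y : ℝ) :
    HasDerivAt (fun y => cut h θ m P σ y R) (cutDeriv h h' θ m P σ y R) y := by
  rcases eq_or_ne y 0 with rfl | hy
  · have hlow : ∀ᶠ y in 𝓝 0, |h y| < Real.exp (-L) * m σ R :=
      hh.continuous.abs.continuousAt.eventually_lt continuousAt_const (by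
        rw [hh.zero, abs_zero]; positivity)
    rw [cutDeriv_eq_zero hh hP hm hlow.self_of_nhds]
    refine (hasDerivAt_const (0 : ℝ) (0 : ℝ)).congr_of_eventuallyEq ?_
    filter_upwards [hlow] with y hy using cut_eq_zero hh hP hm hy
  · have hne := hh.ne_zero hy
    have e1 := hh.hasDerivAt y hy
    have e2 := (e1.div_const (m σ R)).log (div_ne_zero hne hm.ne')
    have e3 : HasDerivAt (fun y => θ * y) θ y := by simpa using (hasDerivAt_id y).const_mul θ
    have e4 := (e1.fun_sub e3).fun_mul ((hP.hasDerivAt _).comp y e2)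
    refine e4.congr_deriv ?_
    simp only [cutDeriv, Function.comp]
    field_simp

theorem hasDerivAt_log_scale {a : ℝ} (ha : a ≠ 0) {μ : ℝ → ℝ} {R : ℝ} (hμ : DifferentiableAt ℝ μ R)
    (hm : 0 < μ R) : HasDerivAt (fun R => Real.log (a / μ R)) (-(deriv μ R / μ R)) R := by
  have e := ((hasDerivAt_const R a).fun_div hμ.hasDerivAt hm.ne').log
    (div_ne_zero ha hm.ne')
  refine e.congr_deriv ?_
  field_simp
  ring

theorem hasDerivAt_cut_R (hh : IsProfile ε θ h h') (hP : IsCutoff L P) {σ R : ℝ}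
    (hmd : DifferentiableAt ℝ (m σ) R) (hm : 0 < m σ R) (y : ℝ) :
    HasDerivAt (fun R => cut h θ m P σ y R)
      (-(cut h θ m (deriv P) σ y R * (deriv (m σ) R / m σ R))) R := by
  rcases eq_or_ne y 0 with rfl | hy
  · simpa [cut, hh.zero] using hasDerivAt_const R (0 : ℝ)
  · have e := ((hP.hasDerivAt _).comp R (hasDerivAt_log_scale (hh.ne_zero hy) hmd hm)).const_mul
      (h y - θ * y)
    exact e.congr_deriv (by simp only [cut]; ring)

theorem hasDerivAt_cutDeriv_R (hh : IsProfile ε θ h h') (hP : IsCutoff L P) {σ R : ℝ}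
    (hmd : DifferentiableAt ℝ (m σ) R) (hm : 0 < m σ R) (y : ℝ) :
    HasDerivAt (fun R => cutDeriv h h' θ m P σ y R)
      (-(cutDeriv h h' θ m (deriv P) σ y R * (deriv (m σ) R / m σ R))) R := by
  rcases eq_or_ne y 0 with rfl | hy
  · simpa [cutDeriv, hh.zero, hh.deriv_zero] using hasDerivAt_const R (0 : ℝ)
  · have e0 := hasDerivAt_log_scale (hh.ne_zero hy) hmd hm
    have e := (((hP.hasDerivAt _).comp R e0).const_mul (h' y - θ)).fun_add
      (((hP.deriv.hasDerivAt _).comp R e0).const_mul ((h y - θ * y) / h y * h' y))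
    exact e.congr_deriv (by simp only [cutDeriv]; ring)

/-- Away from the origin one of three open conditions holds: `h y` is much smaller than the scale,
`h y` is larger than the scale, or neither of the two vanishes. -/
theorem eventually_regimes (hh : IsProfile ε θ h h') (hm : IsScale K m₀ m) (L : ℝ) {p : ℝ × ℝ × ℝ}
    (hp : p ≠ 0) :
    (∀ᶠ q in 𝓝 p, 0 < m q.1 q.2.2 ∧ |h q.2.1| < Real.exp (-L) * m q.1 q.2.2) ∨
      (p.2.1 ≠ 0 ∧ ∀ᶠ q in 𝓝 p, 0 ≤ m q.1 q.2.2 ∧ m q.1 q.2.2 ≤ |h q.2.1|) ∨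
      (0 < m p.1 p.2.2 ∧ p.2.1 ≠ 0) := by
  have hmc : Continuous fun q : ℝ × ℝ × ℝ => m q.1 q.2.2 :=
    hm.contDiff.continuous.comp (by fun_prop : Continuous fun q : ℝ × ℝ × ℝ => (q.1, q.2.2))
  have hhc : Continuous fun q : ℝ × ℝ × ℝ => |h q.2.1| := (hh.continuous.comp (by fun_prop)).abs
  by_cases h0 : p.1 ≠ 0 ∨ p.2.2 ≠ 0
  · have hpos := hm.pos _ _ h0
    by_cases hy : p.2.1 = 0
    · left
      refine (continuousAt_const.eventually_lt hmc.continuousAt hpos).and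
        (hhc.continuousAt.eventually_lt (hmc.const_mul _).continuousAt ?_)
      rw [hy, hh.zero, abs_zero]
      exact mul_pos (Real.exp_pos _) hpos
    · exact Or.inr (Or.inr ⟨hpos, hy⟩)
  · push Not at h0
    have hy : p.2.1 ≠ 0 := fun hy => hp (Prod.ext h0.1 (Prod.ext hy h0.2))
    have hnonneg : ∀ σ R, 0 ≤ m σ R := fun σ R => by
      by_cases h : σ ≠ 0 ∨ R ≠ 0
      · exact (hm.pos σ R h).le
      · push Not at h
        rw [h.1, h.2, hm.zero]
    refine Or.inr (Or.inl ⟨hy, ?_⟩)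
    filter_upwards [hmc.continuousAt.eventually_lt hhc.continuousAt (x₀ := p) (by
      rw [h0.1, h0.2, hm.zero]; exact abs_pos.2 (hh.ne_zero hy))] with q hq
    exact ⟨hnonneg _ _, hq.le⟩

theorem contDiffAt_cut (hh : IsProfile ε θ h h') (hP : IsCutoff L P) (hm : IsScale K m₀ m)
    {p : ℝ × ℝ × ℝ} (hp : p ≠ 0) : ContDiffAt ℝ ∞ ↿(cut h θ m P) p := by
  have hlin : p.2.1 ≠ 0 → ContDiffAt ℝ ∞ (fun q : ℝ × ℝ × ℝ => h q.2.1) p := fun hy =>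
    (hh.contDiffAt _ hy).comp p (by fun_prop : ContDiffAt ℝ ∞ (fun q : ℝ × ℝ × ℝ => q.2.1) p)
  rcases eventually_regimes hh hm L hp with h1 | ⟨hy, h1⟩ | ⟨h1, hy⟩
  · refine (contDiffAt_const (c := (0 : ℝ))).congr_of_eventuallyEq ?_
    filter_upwards [h1] with q hq using cut_eq_zero hh hP hq.1 hq.2
  · have e : ContDiffAt ℝ ∞ (fun q : ℝ × ℝ × ℝ => (h q.2.1 - θ * q.2.1) * P 0) p :=
      ((hlin hy).sub (by fun_prop)).mul contDiffAt_const
    refine e.congr_of_eventuallyEq ?_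
    filter_upwards [h1] with q hq using cut_eq_of_le hP hq.1 hq.2
  · have hmc : ContDiff ℝ ∞ fun q : ℝ × ℝ × ℝ => m q.1 q.2.2 :=
      hm.contDiff.comp (by fun_prop : ContDiff ℝ ∞ fun q : ℝ × ℝ × ℝ => (q.1, q.2.2))
    have e1 := ((hlin hy).div hmc.contDiffAt h1.ne').log (div_ne_zero (hh.ne_zero hy) h1.ne')
    exact ((hlin hy).sub (by fun_prop)).mul (hP.contDiff.contDiffAt.comp p e1)

theorem continuousAt_cutDeriv (hh : IsProfile ε θ h h') (hP : IsCutoff L P) (hm : IsScale K m₀ m)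
    {p : ℝ × ℝ × ℝ} (hp : p ≠ 0) : ContinuousAt ↿(cutDeriv h h' θ m P) p := by
  have hlin : ContinuousAt (fun q : ℝ × ℝ × ℝ => h q.2.1) p :=
    (hh.continuous.comp (by fun_prop)).continuousAt
  have hder : p.2.1 ≠ 0 → ContinuousAt (fun q : ℝ × ℝ × ℝ => h' q.2.1) p := fun hy =>
    (hh.continuousAt_deriv hy).comp (f := fun q : ℝ × ℝ × ℝ => q.2.1) (by fun_prop)
  rcases eventually_regimes hh hm L hp with h1 | ⟨hy, h1⟩ | ⟨h1, hy⟩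
  · refine (continuousAt_const (y := (0 : ℝ))).congr ?_
    filter_upwards [h1] with q hq using (cutDeriv_eq_zero hh hP hq.1 hq.2).symm
  · have e : ContinuousAt (fun q : ℝ × ℝ × ℝ => (h' q.2.1 - θ) * P 0) p :=
      ((hder hy).sub continuousAt_const).mul continuousAt_const
    refine e.congr ?_
    filter_upwards [h1] with q hq using (cutDeriv_eq_of_le hP hq.1 hq.2).symm
  · have hmc : ContDiff ℝ ∞ fun q : ℝ × ℝ × ℝ => m q.1 q.2.2 :=
      hm.contDiff.comp (by fun_prop : ContDiff ℝ ∞ fun q : ℝ × ℝ × ℝ => (q.1, q.2.2))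
    have hne := hh.ne_zero hy
    have e1 : ContinuousAt (fun q : ℝ × ℝ × ℝ => Real.log (h q.2.1 / m q.1 q.2.2)) p :=
      (hlin.div hmc.continuous.continuousAt h1.ne').log (div_ne_zero hne h1.ne')
    have e2 : ContinuousAt (fun q : ℝ × ℝ × ℝ => P (Real.log (h q.2.1 / m q.1 q.2.2))) p :=
      hP.contDiff.continuous.continuousAt.comp e1
    have e3 : ContinuousAt (fun q : ℝ × ℝ × ℝ => deriv P (Real.log (h q.2.1 / m q.1 q.2.2))) p :=
      hP.deriv.contDiff.continuous.continuousAt.comp e1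
    have e4 : ContinuousAt (fun q : ℝ × ℝ × ℝ => (h q.2.1 - θ * q.2.1) / h q.2.1) p :=
      (hlin.sub (by fun_prop)).div hlin hne
    exact (((hder hy).sub continuousAt_const).mul e2).add ((e4.mul (hder hy)).mul e3)

end cut

/-! ### The generating function -/

theorem IsSlowStep.exists_isCutoff {μ : ℝ} {S : ℝ → ℝ} (hS : IsSlowStep μ S) :
    ∃ L, IsCutoff L S := by
  obtain ⟨L, -, hL⟩ := hS.eq_zero
  exact ⟨L, hS.contDiff, hL, fun x hx => by rw [hS.eq_one x hx, hS.eq_one 0 le_rfl]⟩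

theorem IsSlowStep.le_one {μ : ℝ} {S : ℝ → ℝ} (hS : IsSlowStep μ S) (x : ℝ) : S x ≤ 1 := by
  have := monotone_of_deriv_nonneg (hS.contDiff.differentiable (by simp)) hS.deriv_nonneg
    (le_max_left x 0)
  rwa [hS.eq_one _ (le_max_right x 0)] at this

/-- The logarithmic derivative of the scale. -/
noncomputable def logSlope (m : ℝ → ℝ → ℝ) (σ R : ℝ) : ℝ := R * (deriv (m σ) R / m σ R)

/-- The generating function: `y + genT` is the profile `h` smoothed below the scale `m σ R`, with
slope `θ` near `y = 0`. -/
noncomputable def genT (h : ℝ → ℝ) (θ : ℝ) (m : ℝ → ℝ → ℝ) (S : ℝ → ℝ) (σ y R : ℝ) : ℝ :=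
  (θ - 1) * y + cut h θ m S σ y R

/-- The conformal factor `1 + ∂T/∂y` of the generating function. -/
noncomputable def genW (h h' : ℝ → ℝ) (θ : ℝ) (m : ℝ → ℝ → ℝ) (S : ℝ → ℝ) (σ y R : ℝ) : ℝ :=
  θ + cutDeriv h h' θ m S σ y R

/-- The displacement `-∂T/∂R` in the direction `x`. -/
noncomputable def genA (h : ℝ → ℝ) (θ : ℝ) (m : ℝ → ℝ → ℝ) (S : ℝ → ℝ) (σ y R : ℝ) : ℝ :=
  cut h θ m (deriv S) σ y R * (deriv (m σ) R / m σ R)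

/-- The quantity `∂(y + T - R ∂T/∂R)/∂y`. -/
noncomputable def genD (h h' : ℝ → ℝ) (θ : ℝ) (m : ℝ → ℝ → ℝ) (S : ℝ → ℝ) (σ y R : ℝ) : ℝ :=
  θ + cutDeriv h h' θ m (fun x => S x + logSlope m σ R * deriv S x) σ y R

section gen
variable {ε θ K m₀ μ : ℝ} {h h' S : ℝ → ℝ} {m : ℝ → ℝ → ℝ}

theorem IsScale.nonneg (hm : IsScale K m₀ m) (σ R : ℝ) : 0 ≤ m σ R := by
  by_cases h : σ ≠ 0 ∨ R ≠ 0
  · exact (hm.pos σ R h).le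
  · push Not at h
    rw [h.1, h.2, hm.zero]

theorem IsScale.differentiable (hm : IsScale K m₀ m) (σ : ℝ) : Differentiable ℝ (m σ) :=
  (hm.contDiff.comp (by fun_prop : ContDiff ℝ ∞ fun R : ℝ => (σ, R))).differentiable (by simp)

theorem IsScale.logSlope_nonneg (hm : IsScale K m₀ m) (σ R : ℝ) : 0 ≤ logSlope m σ R := by
  rw [logSlope, ← mul_div_assoc]
  exact div_nonneg (hm.deriv_nonneg σ R) (hm.nonneg σ R)

theorem IsScale.logSlope_le (hm : IsScale K m₀ m) (hK : 0 < K) (σ R : ℝ) :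
    logSlope m σ R ≤ 2 * K := by
  rw [logSlope, ← mul_div_assoc]
  exact div_le_of_le_mul₀ (hm.nonneg σ R) (by positivity) (hm.deriv_le σ R)

theorem le_genW (hh : IsProfile ε θ h h') (hS : IsSlowStep μ S) (σ y R : ℝ) :
    θ ≤ genW h h' θ m S σ y R := by
  rcases eq_or_ne y 0 with rfl | hy
  · simp [genW, cutDeriv, hh.zero, hh.deriv_zero]
  · have h1 := hh.le_deriv y hy
    have h2 := hh.pos
    have h3 := (hh.ratio_mem hy).1
    have h4 := hS.nonneg (Real.log (h y / m σ R))
    have h5 := hS.deriv_nonneg (Real.log (h y / m σ R))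
    rw [genW, cutDeriv]
    have e1 := mul_nonneg (show 0 ≤ h' y - θ by linarith) h4
    have e2 := mul_nonneg (mul_nonneg (show 0 ≤ (h y - θ * y) / h y by linarith)
      (show 0 ≤ h' y by linarith)) h5
    linarith

/-- The smoothing step is so slow that the term with the second derivative of `S` is absorbed by
the term with `S`. -/
theorem le_genD (hh : IsProfile ε θ h h') (hS : IsSlowStep μ S) (hm : IsScale K m₀ m) (hK : 0 < K)
    (hμ : 0 < μ) (hKμ : 4 * K * μ ≤ 1) (σ y R : ℝ) : θ ≤ genD h h' θ m S σ y R := by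
  rcases eq_or_ne y 0 with rfl | hy
  · simp [genD, cutDeriv, hh.zero, hh.deriv_zero]
  · obtain ⟨L, hL⟩ := hS.exists_isCutoff
    have h1 := hh.le_deriv y hy
    have h2 := hh.pos
    obtain ⟨h3, h3'⟩ := hh.ratio_mem hy
    rw [genD, cutDeriv_add_mul hL hL.deriv, cutDeriv, cutDeriv]
    set x := Real.log (h y / m σ R)
    set b := logSlope m σ R
    set l := (h y - θ * y) / h y
    have h4 := hS.nonneg x
    have h5 := hS.deriv_nonneg x
    have h6 := hS.le_deriv_deriv x
    have hb0 : 0 ≤ b := hm.logSlope_nonneg σ R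
    have hb1 : b ≤ 2 * K := hm.logSlope_le hK σ R
    have hlh : 0 ≤ l * h' y := mul_nonneg (by linarith) (by linarith)
    have hlh' : l * h' y ≤ h' y := mul_le_of_le_one_left (by linarith) h3'
    have e1 : 0 ≤ (h' y - θ) * (b * deriv S x) :=
      mul_nonneg (by linarith) (mul_nonneg hb0 h5)
    have e2 : 0 ≤ l * h' y * deriv S x := mul_nonneg hlh h5
    have e3 : -(l * h' y * b * (μ * S x)) ≤ l * h' y * b * deriv (deriv S) x := by
      have := mul_le_mul_of_nonneg_left h6 (mul_nonneg hlh hb0)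
      linarith
    have e4 : l * h' y * b * (μ * S x) ≤ h' y * (2 * K) * (μ * S x) :=
      mul_le_mul_of_nonneg_right (mul_le_mul hlh' hb1 hb0 (by linarith)) (mul_nonneg hμ.le h4)
    have e5 : h' y * (2 * K) * (μ * S x) ≤ h' y / 2 * S x := by
      have := mul_le_mul_of_nonneg_right hKμ (mul_nonneg (show 0 ≤ h' y / 2 by linarith) h4)
      linarith
    have e6 : h' y / 2 * S x ≤ (h' y - θ) * S x := mul_le_mul_of_nonneg_right (by linarith) h4
    linarith

/-- Functions of `(σ, y, R)` whose only possible discontinuity is the origin, the singular point of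
the family. -/
theorem continuous_of_bound {q : ℝ → ℝ → ℝ → ℝ} (hq : ∀ p : ℝ × ℝ × ℝ, p ≠ 0 → ContinuousAt ↿q p)
    {b : ℝ × ℝ × ℝ → ℝ} (hb : ContinuousAt b 0) (hb0 : b 0 = 0) (hqb : ∀ p, |↿q p| ≤ b p) :
    Continuous ↿q := by
  rw [continuous_iff_continuousAt]
  intro p
  rcases eq_or_ne p 0 with rfl | hp
  · have h0 : ↿q (0 : ℝ × ℝ × ℝ) = 0 := by
      have := hqb 0
      rwa [hb0, abs_nonpos_iff] at this
    rw [ContinuousAt, h0]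
    exact squeeze_zero_norm hqb (by simpa [ContinuousAt, hb0] using hb)
  · exact hq p hp

theorem contDiffAt_genT (hh : IsProfile ε θ h h') (hS : IsSlowStep μ S) (hm : IsScale K m₀ m)
    {p : ℝ × ℝ × ℝ} (hp : p ≠ 0) : ContDiffAt ℝ ∞ ↿(genT h θ m S) p := by
  obtain ⟨L, hL⟩ := hS.exists_isCutoff
  exact ContDiffAt.add (f := fun p : ℝ × ℝ × ℝ => (θ - 1) * p.2.1) (by fun_prop)
    (contDiffAt_cut hh hL hm hp)

theorem continuous_genT (hh : IsProfile ε θ h h') (hS : IsSlowStep μ S) (hm : IsScale K m₀ m) :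
    Continuous ↿(genT h θ m S) := by
  have hhc : Continuous fun p : ℝ × ℝ × ℝ => |h p.2.1| := (hh.continuous.comp (by fun_prop)).abs
  refine continuous_of_bound (b := fun p => |(θ - 1) * p.2.1| + |h p.2.1|)
    (fun p hp => (contDiffAt_genT hh hS hm hp).continuousAt) (by fun_prop) (by simp [hh.zero])
    fun p => ?_
  refine (abs_add_le _ _).trans (add_le_add_right ?_ _)
  change |(h p.2.1 - θ * p.2.1) * S _| ≤ _
  rw [abs_mul, abs_of_nonneg (hS.nonneg _)]
  exact (mul_le_of_le_one_right (abs_nonneg _) (hS.le_one _)).trans (hh.abs_sub_le _)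

/-- The displacement in the direction `x` is at most proportional to `R`: it vanishes where `h y`
exceeds the scale, and the scale is quadratic in `R`. -/
theorem exists_abs_genA_le (hh : IsProfile ε θ h h') (hS : IsSlowStep μ S) (hm : IsScale K m₀ m) :
    ∃ M, ∀ σ y R, |genA h θ m S σ y R| ≤ M * |R| := by
  obtain ⟨L, hL⟩ := hS.exists_isCutoff
  obtain ⟨M, hM⟩ := (isCompact_Icc (a := -L) (b := 0)).exists_bound_of_continuousOn
    hL.deriv.contDiff.continuous.continuousOn
  have hM' : ∀ x, |deriv S x| ≤ max M 0 := fun x => by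
    by_cases hx : x ∈ Icc (-L) 0
    · exact (hM x hx).trans (le_max_left _ _)
    · rw [mem_Icc, not_and_or, not_le, not_le] at hx
      have : deriv S x = 0 := hx.elim (fun h => hL.deriv_eq_zero_of_le h.le)
        fun h => hL.deriv_eq_zero_of_nonneg h.le
      simp [this]
  refine ⟨max M 0 * (m₀ * (2 * K)), fun σ y R => ?_⟩
  have hcut : |cut h θ m (deriv S) σ y R| ≤ max M 0 * m σ R := by
    rcases le_total (m σ R) |h y| with h1 | h1
    · rw [cut_eq_of_le hL.deriv (hm.nonneg σ R) h1, hL.deriv_eq_zero_of_nonneg le_rfl, mul_zero,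
        abs_zero]
      exact mul_nonneg (le_max_right _ _) (hm.nonneg σ R)
    · rw [cut, abs_mul, mul_comm]
      exact mul_le_mul (hM' _) ((hh.abs_sub_le y).trans h1) (abs_nonneg _) (le_max_right _ _)
  rw [genA, abs_mul, abs_div, abs_of_nonneg (hm.nonneg σ R)]
  rcases (hm.nonneg σ R).eq_or_lt with h0 | h0
  · rw [← h0, div_zero, mul_zero]
    exact mul_nonneg (mul_nonneg (le_max_right _ _) (nonneg_of_mul_nonneg_left
      ((abs_nonneg _).trans (hm.abs_deriv_le 0 1)) (by simp))) (abs_nonneg _)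
  · calc |cut h θ m (deriv S) σ y R| * (|deriv (m σ) R| / m σ R)
        ≤ max M 0 * m σ R * (|deriv (m σ) R| / m σ R) :=
          mul_le_mul_of_nonneg_right hcut (by positivity)
      _ = max M 0 * |deriv (m σ) R| := by field_simp
      _ ≤ _ := by
        rw [mul_assoc]
        exact mul_le_mul_of_nonneg_left (hm.abs_deriv_le σ R) (le_max_right _ _)

theorem continuous_genA (hh : IsProfile ε θ h h') (hS : IsSlowStep μ S) (hm : IsScale K m₀ m) :
    Continuous ↿(genA h θ m S) := by
  obtain ⟨L, hL⟩ := hS.exists_isCutoff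
  obtain ⟨M, hM⟩ := exists_abs_genA_le hh hS hm
  have hder : Continuous fun p : ℝ × ℝ × ℝ => deriv (m p.1) p.2.2 := by
    have e : ∀ σ R, deriv (m σ) R = fderiv ℝ ↿m (σ, R) (0, 1) := fun σ R => by
      have h1 : HasDerivAt (fun R : ℝ => (σ, R)) ((0 : ℝ), (1 : ℝ)) R :=
        (hasDerivAt_const _ _).prodMk (hasDerivAt_id _)
      exact (HasFDerivAt.comp_hasDerivAt R (f := fun R : ℝ => (σ, R))
        ((hm.contDiff.differentiable (by simp)) (σ, R)).hasFDerivAt h1).deriv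
    simp only [e]
    exact ((hm.contDiff.continuous_fderiv (by simp)).comp (by fun_prop)).clm_apply
      continuous_const
  have hmc : Continuous fun q : ℝ × ℝ × ℝ => m q.1 q.2.2 :=
    hm.contDiff.continuous.comp (by fun_prop : Continuous fun q : ℝ × ℝ × ℝ => (q.1, q.2.2))
  refine continuous_of_bound (b := fun p => M * |p.2.2|) (fun p hp => ?_) (by fun_prop) (by simp)
    fun p => hM _ _ _
  rcases eventually_regimes hh hm L hp with h1 | ⟨-, h1⟩ | ⟨h1, hy⟩
  · refine (continuousAt_const (y := (0 : ℝ))).congr ?_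
    filter_upwards [h1] with q hq
    change _ = genA h θ m S q.1 q.2.1 q.2.2
    rw [genA, cut_eq_zero hh hL.deriv hq.1 hq.2, zero_mul]
  · refine (continuousAt_const (y := (0 : ℝ))).congr ?_
    filter_upwards [h1] with q hq
    change _ = genA h θ m S q.1 q.2.1 q.2.2
    rw [genA, cut_eq_of_le hL.deriv hq.1 hq.2, hL.deriv_eq_zero_of_nonneg le_rfl, mul_zero,
      zero_mul]
  · exact (contDiffAt_cut hh hL.deriv hm hp).continuousAt.mul
      (hder.continuousAt.div hmc.continuousAt h1.ne')

theorem continuous_div_genW (hh : IsProfile ε θ h h') (hS : IsSlowStep μ S)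
    (hm : IsScale K m₀ m) : Continuous ↿(fun σ y R => R / genW h h' θ m S σ y R) := by
  obtain ⟨L, hL⟩ := hS.exists_isCutoff
  have hW := le_genW (m := m) hh hS
  refine continuous_of_bound (b := fun p => |p.2.2| / θ) (fun p hp => ?_) (by fun_prop) (by simp)
    fun p => ?_
  · exact ContinuousAt.div (f := fun p : ℝ × ℝ × ℝ => p.2.2) (by fun_prop)
      (continuousAt_const.add (continuousAt_cutDeriv hh hL hm hp))
      (hh.pos.trans_le (hW _ _ _)).ne'
  · change |p.2.2 / genW h h' θ m S p.1 p.2.1 p.2.2| ≤ _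
    rw [abs_div]
    exact div_le_div_of_nonneg_left (abs_nonneg _) hh.pos ((hW _ _ _).trans (le_abs_self _))

theorem hasDerivAt_genT_y (hh : IsProfile ε θ h h') (hS : IsSlowStep μ S) {σ R : ℝ}
    (h0 : 0 < m σ R) (y : ℝ) :
    HasDerivAt (fun y => genT h θ m S σ y R) (genW h h' θ m S σ y R - 1) y := by
  obtain ⟨L, hL⟩ := hS.exists_isCutoff
  have e1 : HasDerivAt (fun y => (θ - 1) * y) (θ - 1) y := by
    simpa using (hasDerivAt_id y).const_mul (θ - 1)
  exact (e1.fun_add (hasDerivAt_cut_y hh hL h0 y)).congr_deriv (by rw [genW]; ring)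

theorem hasDerivAt_genT_R (hh : IsProfile ε θ h h') (hS : IsSlowStep μ S) (hm : IsScale K m₀ m)
    {σ R : ℝ} (h0 : 0 < m σ R) (y : ℝ) :
    HasDerivAt (genT h θ m S σ y) (-genA h θ m S σ y R) R := by
  obtain ⟨L, hL⟩ := hS.exists_isCutoff
  exact (hasDerivAt_cut_R hh hL (hm.differentiable σ R) h0 y).const_add _

theorem hasDerivAt_genB_y (hh : IsProfile ε θ h h') (hS : IsSlowStep μ S) {σ R : ℝ}
    (h0 : 0 < m σ R) (y : ℝ) :
    HasDerivAt (fun y => y + genT h θ m S σ y R + R * genA h θ m S σ y R)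
      (genD h h' θ m S σ y R) y := by
  obtain ⟨L, hL⟩ := hS.exists_isCutoff
  have e1 : HasDerivAt (fun y => θ * y) θ y := by
    simpa using (hasDerivAt_id y).const_mul θ
  have e2 := e1.fun_add (hasDerivAt_cut_y hh (hL.add_mul hL.deriv (logSlope m σ R)) h0 y)
  refine e2.congr_of_eventuallyEq (.of_forall fun y => ?_)
  simp only [cut_add_mul, genT, genA, logSlope]
  ring

theorem hasDerivAt_div_genW_R (hh : IsProfile ε θ h h') (hS : IsSlowStep μ S)
    (hm : IsScale K m₀ m) {σ R : ℝ} (h0 : 0 < m σ R) (y : ℝ) :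
    HasDerivAt (fun R => R / genW h h' θ m S σ y R)
      (genD h h' θ m S σ y R / genW h h' θ m S σ y R ^ 2) R := by
  obtain ⟨L, hL⟩ := hS.exists_isCutoff
  have hW := (hh.pos.trans_le (le_genW (m := m) hh hS σ y R)).ne'
  have e := (hasDerivAt_id R).fun_div
    ((hasDerivAt_cutDeriv_R hh hL (hm.differentiable σ R) h0 y).const_add θ) hW
  refine e.congr_deriv ?_
  rw [genD, cutDeriv_add_mul hL hL.deriv, genW, logSlope]
  simp only [id]
  ring

theorem cut_eq_of_le_abs (hh : IsProfile ε θ h h') (hm : IsScale K m₀ m) {P : ℝ → ℝ} {L : ℝ}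
    (hP : IsCutoff L P) (hm₀ : m₀ ≤ ε) {σ y R : ℝ}
    (hy : ε ≤ |y|) : cut h θ m P σ y R = (y - θ * y) * P 0 := by
  rw [cut_eq_of_le hP (hm.nonneg _ _) (by
    rw [hh.eq_self y hy]; exact (hm.le _ _).trans (hm₀.trans hy)), hh.eq_self y hy]

theorem genT_eq_zero (hh : IsProfile ε θ h h') (hS : IsSlowStep μ S) (hm : IsScale K m₀ m)
    (hm₀ : m₀ ≤ ε) {σ y R : ℝ} (hy : ε ≤ |y|) : genT h θ m S σ y R = 0 := by
  obtain ⟨L, hL⟩ := hS.exists_isCutoff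
  rw [genT, cut_eq_of_le_abs hh hm hL hm₀ hy, hS.eq_one 0 le_rfl]
  ring

theorem genA_eq_zero (hh : IsProfile ε θ h h') (hS : IsSlowStep μ S) (hm : IsScale K m₀ m)
    (hm₀ : m₀ ≤ ε) {σ y R : ℝ} (hy : ε ≤ |y|) : genA h θ m S σ y R = 0 := by
  obtain ⟨L, hL⟩ := hS.exists_isCutoff
  rw [genA, cut_eq_of_le_abs hh hm hL.deriv hm₀ hy, hL.deriv_eq_zero_of_nonneg le_rfl]
  ring

theorem IsProfile.deriv_eq_one (hh : IsProfile ε θ h h') (hε : 0 < ε) {y : ℝ} (hy : ε < |y|) :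
    h' y = 1 := by
  have hy0 : y ≠ 0 := by rintro rfl; rw [abs_zero] at hy; linarith
  refine (hh.hasDerivAt y hy0).unique ((hasDerivAt_id y).congr_of_eventuallyEq ?_)
  filter_upwards [continuous_abs.continuousAt.eventually (Ioi_mem_nhds hy)] with z hz
  exact hh.eq_self z (le_of_lt hz)

theorem genW_eq_one (hh : IsProfile ε θ h h') (hS : IsSlowStep μ S) (hm : IsScale K m₀ m)
    (hε : 0 < ε) (hm₀ : m₀ ≤ ε) {σ y R : ℝ} (hy : ε < |y|) :
    genW h h' θ m S σ y R = 1 := by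
  obtain ⟨L, hL⟩ := hS.exists_isCutoff
  rw [genW, cutDeriv_eq_of_le hL (hm.nonneg _ _) (by
    rw [hh.eq_self y hy.le]; exact (hm.le _ _).trans (hm₀.trans hy.le)), hS.eq_one 0 le_rfl,
    hh.deriv_eq_one hε hy]
  ring

theorem strictMono_genB (hh : IsProfile ε θ h h') (hS : IsSlowStep μ S) (hm : IsScale K m₀ m)
    (hK : 0 < K) (hμ : 0 < μ) (hKμ : 4 * K * μ ≤ 1) (σ R : ℝ) :
    StrictMono fun y => y + genT h θ m S σ y R + R * genA h θ m S σ y R := by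
  by_cases h0 : σ ≠ 0 ∨ R ≠ 0
  · refine strictMono_of_deriv_pos fun y => ?_
    rw [(hasDerivAt_genB_y hh hS (hm.pos σ R h0) y).deriv]
    exact hh.pos.trans_le (le_genD hh hS hm hK hμ hKμ σ y R)
  · push Not at h0
    obtain ⟨L, hL⟩ := hS.exists_isCutoff
    have : (fun y => y + genT h θ m S σ y R + R * genA h θ m S σ y R) = h := funext fun y => by
      rw [h0.1, h0.2, genT, cut_eq_of_le hL (hm.nonneg _ _) (by rw [hm.zero]; exact abs_nonneg _),
        hS.eq_one 0 le_rfl]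
      ring
    rw [this]
    exact hh.strictMono

theorem strictMono_div_genW (hh : IsProfile ε θ h h') (hS : IsSlowStep μ S)
    (hm : IsScale K m₀ m) (hK : 0 < K) (hμ : 0 < μ) (hKμ : 4 * K * μ ≤ 1) (σ y : ℝ) :
    StrictMono fun R => R / genW h h' θ m S σ y R := by
  have hc : Continuous fun R => R / genW h h' θ m S σ y R :=
    (continuous_div_genW hh hS hm).comp (by fun_prop : Continuous fun R : ℝ => (σ, y, R))
  have hd : ∀ R ≠ 0, 0 < deriv (fun R => R / genW h h' θ m S σ y R) R := fun R hR => by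
    rw [(hasDerivAt_div_genW_R hh hS hm (hm.pos σ R (Or.inr hR)) y).deriv]
    exact div_pos (hh.pos.trans_le (le_genD hh hS hm hK hμ hKμ σ y R))
      (pow_pos (hh.pos.trans_le (le_genW hh hS σ y R)) 2)
  refine StrictMonoOn.Iic_union_Ici (a := 0) ?_ ?_
  · refine strictMonoOn_of_deriv_pos (convex_Iic 0) hc.continuousOn fun R hR => ?_
    rw [interior_Iic] at hR
    exact hd R (ne_of_lt hR)
  · refine strictMonoOn_of_deriv_pos (convex_Ici 0) hc.continuousOn fun R hR => ?_
    rw [interior_Ici] at hR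
    exact hd R (ne_of_gt hR)

theorem surjective_div_genW (hh : IsProfile ε θ h h') (hS : IsSlowStep μ S)
    (hm : IsScale K m₀ m) (σ y : ℝ) :
    Function.Surjective fun R => R / genW h h' θ m S σ y R := by
  have hc : Continuous fun R => R / genW h h' θ m S σ y R :=
    (continuous_div_genW hh hS hm).comp (by fun_prop : Continuous fun R : ℝ => (σ, y, R))
  have hW : 0 < genW h h' θ m S σ y 1 := hh.pos.trans_le (le_genW hh hS σ y 1)
  have hfar : ∀ R : ℝ, 1 ≤ |R| → genW h h' θ m S σ y R = genW h h' θ m S σ y 1 := fun R hR => by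
    simp only [genW, cutDeriv, hm.eq_of_one_le σ R hR, hm.eq_of_one_le σ 1 (by simp)]
  intro r
  set n := max 1 (|r| * genW h h' θ m S σ y 1)
  have hn : 1 ≤ n := le_max_left _ _
  have hn' : |r| ≤ n / genW h h' θ m S σ y 1 := by
    rw [le_div_iff₀ hW]; exact le_max_right _ _
  obtain ⟨R, -, hR⟩ := intermediate_value_Icc (show -n ≤ n by linarith) hc.continuousOn
    (show r ∈ Icc _ _ by
      rw [hfar n (by rw [abs_of_pos (by linarith)]; exact hn),
        hfar (-n) (by rw [abs_neg, abs_of_pos (by linarith)]; exact hn), neg_div]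
      exact ⟨by linarith [neg_abs_le r], by linarith [le_abs_self r]⟩)
  exact ⟨R, hR⟩

end gen

/-! ### Periodization in the angular variable -/

/-- The `1`-periodic function of `y` which agrees with `p` on `[-1/2, 1/2)`. -/
noncomputable def periodize (p : ℝ → ℝ → ℝ → ℝ) (σ y R : ℝ) : ℝ := p σ (y - round y) R

/-- The function of `y` is constant, equal to `c`, outside `(-1/4, 1/4)`. -/
def IsLocalized (c : ℝ) (p : ℝ → ℝ → ℝ → ℝ) : Prop := ∀ σ y R, 1 / 4 ≤ |y| → p σ y R = c

section periodize
variable {c : ℝ} {p : ℝ → ℝ → ℝ → ℝ}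

theorem periodize_periodic (p : ℝ → ℝ → ℝ → ℝ) (σ R : ℝ) :
    Function.Periodic (fun y => periodize p σ y R) 1 := fun y => by
  simp only [periodize, round_add_one, Int.cast_add, Int.cast_one]
  congr 1
  ring

theorem IsLocalized.periodize_eq (hp : IsLocalized c p) {y : ℝ} {k : ℤ} (hy : |y - k| < 3 / 4)
    (σ R : ℝ) : periodize p σ y R = p σ (y - k) R := by
  by_cases hk : round y = k
  · rw [periodize, hk]
  · have h1 : (1 : ℝ) ≤ |(round y : ℝ) - k| := by
      exact_mod_cast Int.one_le_abs (sub_ne_zero.2 hk)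
    have h2 := abs_sub_round y
    have h3 : |(round y : ℝ) - k| ≤ |y - k| + |y - round y| := by
      rw [show (round y : ℝ) - k = (y - k) - (y - round y) by ring]
      exact abs_sub _ _
    rw [periodize, hp _ _ _ (by linarith), hp _ _ _ (by linarith)]

theorem eventually_abs_sub_round_lt (y : ℝ) : ∀ᶠ z : ℝ in 𝓝 y, |z - round y| < 3 / 4 := by
  have hc : ContinuousAt (fun z : ℝ => |z - round y|) y := by fun_prop
  exact hc.eventually_lt continuousAt_const ((abs_sub_round y).trans_lt (by norm_num))

theorem IsLocalized.periodize_eventuallyEq (hp : IsLocalized c p) (q : ℝ × ℝ × ℝ) :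
    ↿(periodize p) =ᶠ[𝓝 q] fun r => ↿p (r.1, r.2.1 - round q.2.1, r.2.2) := by
  have hc : ContinuousAt (fun r : ℝ × ℝ × ℝ => r.2.1) q := by fun_prop
  filter_upwards [hc.eventually (eventually_abs_sub_round_lt q.2.1)] with r hr
  exact hp.periodize_eq hr _ _

theorem IsLocalized.continuous_periodize (hp : IsLocalized c p) (hc : Continuous ↿p) :
    Continuous ↿(periodize p) := by
  rw [continuous_iff_continuousAt]
  intro q
  exact (hc.comp (by fun_prop : Continuous fun r : ℝ × ℝ × ℝ =>
    (r.1, r.2.1 - (round q.2.1 : ℝ), r.2.2))).continuousAt.congr (hp.periodize_eventuallyEq q).symm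

theorem IsLocalized.contDiff_periodize (hp : IsLocalized c p) {σ : ℝ}
    (hc : ContDiff ℝ ∞ ↿(p σ)) : ContDiff ℝ ∞ ↿(periodize p σ) := by
  rw [contDiff_iff_contDiffAt]
  intro q
  refine ((hc.comp (by fun_prop : ContDiff ℝ ∞ fun r : ℝ × ℝ =>
    (r.1 - (round q.1 : ℝ), r.2))).contDiffAt (x := q)).congr_of_eventuallyEq ?_
  have h1 : ContinuousAt (fun r : ℝ × ℝ => r.1) q := by fun_prop
  filter_upwards [h1.eventually (eventually_abs_sub_round_lt q.1)] with r hr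
  exact hp.periodize_eq hr _ _

theorem hasDerivAt_periodize {f f' : ℝ → ℝ} {F : ℝ → ℝ} (hf : ∀ y, HasDerivAt f (f' y) y)
    (hF : ∀ (y : ℝ) (k : ℤ), |y - k| < 3 / 4 → F y = k + f (y - k)) (y : ℝ) :
    HasDerivAt F (f' (y - round y)) y := by
  have h1 : HasDerivAt (fun z : ℝ => (round y : ℝ) + f (z - round y)) (f' (y - round y)) y := by
    have := (hf (y - round y)).comp y ((hasDerivAt_id y).sub_const (round y : ℝ))
    rw [mul_one] at this
    exact this.const_add _
  refine h1.congr_of_eventuallyEq ?_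
  filter_upwards [eventually_abs_sub_round_lt y] with z hz using hF z _ hz

/-- Extending an increasing function from `[-1/2, 1/2]` to the line by translations. -/
theorem strictMono_round_add {b : ℝ → ℝ} (hb : StrictMono b) (hfar : ∀ y, 1 / 4 ≤ |y| → b y = y) :
    StrictMono fun y : ℝ => (round y : ℝ) + b (y - round y) := by
  have h1 : b (1 / 2) = 1 / 2 := hfar _ (by rw [abs_of_pos] <;> norm_num)
  have h2 : b (-(1 / 2)) = -(1 / 2) := hfar _ (by rw [abs_neg, abs_of_pos] <;> norm_num)
  intro y z hyz
  obtain ⟨hy1, hy2⟩ := (round_eq_iff (x := y)).1 rfl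
  obtain ⟨hz1, hz2⟩ := (round_eq_iff (x := z)).1 rfl
  rcases lt_trichotomy (round y) (round z) with h | h | h
  · have h' : (round y : ℝ) + 1 ≤ round z := by exact_mod_cast h
    have e1 : b (y - round y) < 1 / 2 := by rw [← h1]; exact hb (by linarith)
    have e2 : -(1 / 2) ≤ b (z - round z) := by rw [← h2]; exact hb.monotone (by linarith)
    dsimp only
    linarith
  · have : b (y - round y) < b (z - round z) := hb (by rw [h]; linarith)
    dsimp only
    rw [h] at this ⊢
    linarith
  · have h' : (round z : ℝ) + 1 ≤ round y := by exact_mod_cast h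
    linarith

end periodize

section family
variable {ε θ K m₀ μ : ℝ} {h h' S : ℝ → ℝ} {m : ℝ → ℝ → ℝ}

/-- The `B`-component of the family generated by `genT`. -/
noncomputable def perB (h : ℝ → ℝ) (θ : ℝ) (m : ℝ → ℝ → ℝ) (S : ℝ → ℝ) (σ y R : ℝ) : ℝ :=
  y + periodize (genT h θ m S) σ y R + R * periodize (genA h θ m S) σ y R

/-- The `C`-component of the family generated by `genT`. -/
noncomputable def perC (h h' : ℝ → ℝ) (θ : ℝ) (m : ℝ → ℝ → ℝ) (S : ℝ → ℝ) (σ y R : ℝ) : ℝ :=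
  R / periodize (genW h h' θ m S) σ y R

/-- The generating function `genT`, made periodic in `y`, defines a family of homeomorphisms of `Y`,
including for the singular index `σ = 0`. -/
theorem mixedFamily_gen (hε : 0 < ε) (hε' : ε < 1 / 4) (hh : IsProfile ε θ h h')
    (hS : IsSlowStep μ S) (hm : IsScale K m₀ m) (hm₀ : m₀ ≤ ε) (hK : 0 < K) (hμ : 0 < μ)
    (hKμ : 4 * K * μ ≤ 1) :
    MixedFamily (periodize (genA h θ m S)) (perB h θ m S) (perC h h' θ m S) := by
  have hT0 : IsLocalized 0 (genT h θ m S) := fun σ y R hy =>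
    genT_eq_zero hh hS hm hm₀ (by linarith)
  have hA0 : IsLocalized 0 (genA h θ m S) := fun σ y R hy =>
    genA_eq_zero hh hS hm hm₀ (by linarith)
  have hTc := hT0.continuous_periodize (continuous_genT hh hS hm)
  have hAc := hA0.continuous_periodize (continuous_genA hh hS hm)
  have hCc : Continuous ↿(perC h h' θ m S) := by
    -- periodize the displacement `R / W - R`, which is localized
    have e := (show IsLocalized 0 (fun σ y R => R / genW h h' θ m S σ y R - R) from
      fun σ y R hy => by
        simp only [genW_eq_one hh hS hm hε hm₀ (hε'.trans_le hy), div_one, sub_self])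
    have e1 := e.continuous_periodize ((continuous_div_genW hh hS hm).sub (by fun_prop))
    refine (e1.add (by fun_prop : Continuous fun p : ℝ × ℝ × ℝ => p.2.2)).congr fun p => ?_
    exact sub_add_cancel _ _
  have hstab : ∀ σ R, 1 ≤ |R| → m σ R = m 0 R := fun σ R hR => by
    rw [hm.eq_of_one_le σ R hR, hm.eq_of_one_le 0 R hR]
  have hstab' : ∀ σ R, 1 ≤ |R| → deriv (m σ) R = deriv (m 0) R := by
    -- at `|R| = 1` both derivatives are one-sided derivatives of a constant
    intro σ R hR
    have key : ∀ τ, deriv (m τ) R = 0 := by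
      intro τ
      have hd := (hm.differentiable τ R).hasDerivAt
      rcases le_abs.1 hR with h1 | h1
      · exact (uniqueDiffWithinAt_Ici R).eq_deriv _ hd.hasDerivWithinAt
          ((hasDerivWithinAt_const R (Ici R) m₀).congr (fun z hz => hm.eq_of_one_le τ z
            (le_abs.2 (Or.inl (h1.trans hz)))) (hm.eq_of_one_le τ R hR))
      · exact (uniqueDiffWithinAt_Iic R).eq_deriv _ hd.hasDerivWithinAt
          ((hasDerivWithinAt_const R (Iic R) m₀).congr (fun z hz => hm.eq_of_one_le τ z
            (le_abs.2 (Or.inr (h1.trans (neg_le_neg hz))))) (hm.eq_of_one_le τ R hR))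
    rw [key, key]
  have hAst : ∀ σ y R, 1 ≤ |R| →
      periodize (genA h θ m S) σ y R = periodize (genA h θ m S) 0 y R := fun σ y R hR => by
    simp only [periodize, genA, cut, hstab σ R hR, hstab' σ R hR]
  refine ⟨hAc, ?_, hCc, periodize_periodic _, fun σ R y => ?_, fun σ R y => ?_, fun σ R => ?_,
    fun σ y => strictMono_div_genW hh hS hm hK hμ hKμ σ _, fun σ y =>
    surjective_div_genW hh hS hm σ _, hAst, fun σ y R hR => ?_, fun σ y R hR => ?_⟩
  · exact ((by fun_prop : Continuous fun p : ℝ × ℝ × ℝ => p.2.1).add hTc).add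
      ((by fun_prop : Continuous fun p : ℝ × ℝ × ℝ => p.2.2).mul hAc)
  · simp only [perB, periodize_periodic _ σ R y]
    ring
  · simp only [perC, periodize_periodic _ σ R y]
  · have e := strictMono_round_add (strictMono_genB hh hS hm hK hμ hKμ σ R) fun y hy => by
      rw [hT0 σ y R hy, hA0 σ y R hy]
      ring
    convert e using 2 with y
    simp only [perB, periodize]
    ring
  · rw [perB, perB, hAst σ y R hR]
    simp only [periodize, genT, cut, hstab σ R hR]
  · simp only [perC, periodize, genW, cutDeriv, hstab σ R hR]

theorem isContactomorphism_gen (hε : 0 < ε) (hε' : ε < 1 / 4) (hh : IsProfile ε θ h h')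
    (hS : IsSlowStep μ S) (hm : IsScale K m₀ m) (hm₀ : m₀ ≤ ε) (hK : 0 < K) (hμ : 0 < μ)
    (hKμ : 4 * K * μ ≤ 1) {σ : ℝ} (hσ : 0 < σ) :
    IsContactomorphism ((mixedFamily_gen hε hε' hh hS hm hm₀ hK hμ hKμ).homeo σ) := by
  have hpos : ∀ R, 0 < m σ R := fun R => hm.pos σ R (Or.inl hσ.ne')
  have hT0 : IsLocalized 0 (genT h θ m S) := fun σ y R hy =>
    genT_eq_zero hh hS hm hm₀ (by linarith)
  have hA0 : IsLocalized 0 (genA h θ m S) := fun σ y R hy =>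
    genA_eq_zero hh hS hm hm₀ (by linarith)
  have hTs : ContDiff ℝ ∞ ↿(genT h θ m S σ) := by
    rw [contDiff_iff_contDiffAt]
    intro q
    exact (contDiffAt_genT hh hS hm (p := (σ, q.1, q.2)) fun h0 => hσ.ne' congr(($h0).1)).comp q
      (by fun_prop : ContDiffAt ℝ ∞ (fun q : ℝ × ℝ => (σ, q.1, q.2)) q)
  refine MixedFamily.isContactomorphism_homeo _ (T := periodize (genT h θ m S) σ)
    (W := periodize (genW h h' θ m S) σ) (D := periodize (genD h h' θ m S) σ)
    (hT0.contDiff_periodize hTs) (fun y R => ?_)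
    (fun y R => hasDerivAt_genT_R hh hS hm (hpos R) _)
    (fun y R => rfl) (fun y R => rfl) (fun y R => ?_)
    (fun y R => hasDerivAt_div_genW_R hh hS hm (hpos R) _)
    (fun y R => hh.pos.trans_le (le_genW hh hS _ _ _))
    (fun y R => hh.pos.trans_le (le_genD hh hS hm hK hμ hKμ _ _ _))
  · have e := hasDerivAt_periodize (F := fun y => y + periodize (genT h θ m S) σ y R)
      (fun y => (hasDerivAt_id y).fun_add (hasDerivAt_genT_y hh hS (hpos R) y))
      (fun y k hk => by rw [hT0.periodize_eq hk]; simp only [id]; ring) y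
    have := e.fun_sub (hasDerivAt_id y)
    simp only [id, add_sub_cancel_left] at this
    exact this
  · exact hasDerivAt_periodize (hasDerivAt_genB_y hh hS (hpos R)) (fun y k hk => by
      rw [perB, hT0.periodize_eq hk, hA0.periodize_eq hk]; ring) y

/-- The limit homeomorphism maps the torus `S_f` to `S_g` when `f h' = g ∘ h`: on `S_f` the scale
lies below `h`, so that the generating function is `h y - y` there. -/
theorem homeo_zero_image_torus (hε : 0 < ε) (hε' : ε < 1 / 4) (hh : IsProfile ε θ h h')
    (hS : IsSlowStep μ S) (hm : IsScale K m₀ m) (hm₀ : m₀ ≤ ε) (hK : 0 < K) (hμ : 0 < μ)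
    (hKμ : 4 * K * μ ≤ 1) {f g : UnitAddCircle → ℝ} (hf0 : f ((0 : ℝ) : UnitAddCircle) = 0)
    (hfg : ∀ y : ℝ, |y| ≤ 1 / 2 → y ≠ 0 →
      f (y : UnitAddCircle) * h' y = g ((h y : ℝ) : UnitAddCircle))
    (hg0 : g ((0 : ℝ) : UnitAddCircle) = 0)
    (hscale : ∀ y : ℝ, |y| ≤ 1 / 2 → m 0 (g ((h y : ℝ) : UnitAddCircle)) ≤ |h y|) :
    (mixedFamily_gen hε hε' hh hS hm hm₀ hK hμ hKμ).homeo 0 '' torus f = torus g := by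
  set H := mixedFamily_gen hε hε' hh hS hm hm₀ hK hμ hKμ
  obtain ⟨L, hL⟩ := hS.exists_isCutoff
  have key : ∀ x y : ℝ, |y| ≤ 1 / 2 → y - round y = y - (0 : ℤ) →
      H.homeo 0 ((x : UnitAddCircle), (y : UnitAddCircle), f (y : UnitAddCircle)) =
        ((x : UnitAddCircle), ((h y : ℝ) : UnitAddCircle), g ((h y : ℝ) : UnitAddCircle)) := by
    intro x y hy hround
    rw [Int.cast_zero, sub_zero] at hround
    set R := g ((h y : ℝ) : UnitAddCircle) with hR
    have hmR := hscale y hy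
    have eT : genT h θ m S 0 y R = h y - y := by
      rw [genT, cut_eq_of_le hL (hm.nonneg _ _) hmR, hS.eq_one 0 le_rfl]; ring
    have eA : genA h θ m S 0 y R = 0 := by
      rw [genA, cut_eq_of_le hL.deriv (hm.nonneg _ _) hmR, hL.deriv_eq_zero_of_nonneg le_rfl]; ring
    have eW : genW h h' θ m S 0 y R = h' y := by
      rw [genW, cutDeriv_eq_of_le hL (hm.nonneg _ _) hmR, hS.eq_one 0 le_rfl]; ring
    have eC : perC h h' θ m S 0 y R = f (y : UnitAddCircle) := by
      rw [perC, periodize, hround, eW]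
      rcases eq_or_ne y 0 with rfl | hy0
      · rw [hR, hh.zero, hg0, hf0, zero_div]
      · have : 0 < h' y := by linarith [hh.le_deriv y hy0, hh.pos]
        rw [div_eq_iff this.ne', hfg y hy hy0]
    have e := H.homeo_proj 0 (x, y, f (y : UnitAddCircle))
    rw [show proj (x, y, f (y : UnitAddCircle)) = _ from rfl] at e
    refine e.trans ?_
    rw [MixedFamily.lift]
    simp only [fiberInv_eq (H.C_strictMono 0 y) eC]
    rw [perB, periodize, periodize, hround, eT, eA]
    simp [proj]
  have hrep : ∀ q : UnitAddCircle, ∃ y : ℝ, |y| ≤ 1 / 2 ∧ y - round y = y - (0 : ℤ) ∧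
      (y : UnitAddCircle) = q := by
    intro q
    obtain ⟨z, rfl⟩ := QuotientAddGroup.mk_surjective q
    obtain ⟨n, y, hy, rfl⟩ := exists_int_add_mem_Ico z
    refine ⟨y, abs_le.2 ⟨by linarith [hy.1], hy.2.le⟩, ?_, ?_⟩
    · rw [round_eq_zero_iff.2 ⟨by linarith [hy.1], hy.2⟩]
    · simp
  refine Subset.antisymm ?_ ?_
  · rintro - ⟨-, ⟨⟨x, q⟩, rfl⟩, rfl⟩
    obtain ⟨x, rfl⟩ := QuotientAddGroup.mk_surjective x
    obtain ⟨y, hy, hr, rfl⟩ := hrep q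
    exact ⟨((x : UnitAddCircle), ((h y : ℝ) : UnitAddCircle)), (key x y hy hr).symm⟩
  · rintro - ⟨⟨x, q⟩, rfl⟩
    obtain ⟨x, rfl⟩ := QuotientAddGroup.mk_surjective x
    obtain ⟨v, hv, hr, rfl⟩ := hrep q
    -- `h` maps `[-1/2, 1/2)` onto itself
    have hhalf : h (1 / 2) = 1 / 2 := hh.eq_self _ (by rw [abs_of_pos] <;> linarith)
    have hhalf' : h (-(1 / 2)) = -(1 / 2) :=
      hh.eq_self _ (by rw [abs_neg, abs_of_pos] <;> linarith)
    obtain ⟨y, hy, rfl⟩ := intermediate_value_Icc (show -(1 / 2 : ℝ) ≤ 1 / 2 by norm_num)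
      hh.continuous.continuousOn (show v ∈ Icc _ _ by rw [hhalf, hhalf']; exact abs_le.1 hv)
    rw [Int.cast_zero, sub_zero, sub_eq_self, Int.cast_eq_zero, round_eq_zero_iff] at hr
    have hy2 : y < 1 / 2 := hh.strictMono.lt_iff_lt.1 (by rw [hhalf]; exact hr.2)
    refine ⟨_, ⟨((x : UnitAddCircle), (y : UnitAddCircle)), rfl⟩, key x y (abs_le.2 hy) ?_⟩
    rw [round_eq_zero_iff.2 ⟨hy.1, hy2⟩]

end family

/-! ### The profile conjugating the two characteristic foliations -/

section HalfProfile
variable {a : ℝ → ℝ} {ε δ : ℝ}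

/-- The first integral `1 / w²` of the equation `a w' = w³` whose solution is `w = ε` at `ε`. -/
noncomputable def invSq (a : ℝ → ℝ) (ε y : ℝ) : ℝ := 1 / ε ^ 2 + 2 * ∫ z in y..ε, 1 / a z

theorem intervalIntegrable_one_div (ha : Continuous a) (hpos : ∀ y ∈ Ioo (0 : ℝ) (1 / 4), 0 < a y)
    {y z : ℝ} (hy : y ∈ Ioo (0 : ℝ) (1 / 4)) (hz : z ∈ Ioo (0 : ℝ) (1 / 4)) :
    IntervalIntegrable (fun z => 1 / a z) MeasureTheory.volume y z :=
  (continuousOn_const.div ha.continuousOn fun _ hx =>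
    (hpos _ (ordConnected_Ioo.uIcc_subset hy hz hx)).ne').intervalIntegrable

theorem hasDerivAt_invSq (ha : Continuous a) (hpos : ∀ y ∈ Ioo (0 : ℝ) (1 / 4), 0 < a y)
    (hε : ε ∈ Ioo (0 : ℝ) (1 / 4)) {y : ℝ} (hy : y ∈ Ioo (0 : ℝ) (1 / 4)) :
    HasDerivAt (invSq a ε) (-2 / a y) y := by
  have hc : ContinuousOn (fun z => 1 / a z) (Ioo (0 : ℝ) (1 / 4)) :=
    continuousOn_const.div ha.continuousOn fun x hx => (hpos x hx).ne'
  have e := intervalIntegral.integral_hasDerivAt_left (intervalIntegrable_one_div ha hpos hy hε)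
    (hc.stronglyMeasurableAtFilter isOpen_Ioo y hy) (hc.continuousAt (isOpen_Ioo.mem_nhds hy))
  exact ((e.const_mul 2).const_add _).congr_deriv (by ring)

theorem invSq_sub (ha : Continuous a) (hpos : ∀ y ∈ Ioo (0 : ℝ) (1 / 4), 0 < a y)
    (hε : ε ∈ Ioo (0 : ℝ) (1 / 4)) {y z : ℝ} (hy : y ∈ Ioo (0 : ℝ) (1 / 4))
    (hz : z ∈ Ioo (0 : ℝ) (1 / 4)) {F : ℝ → ℝ} (hF : ∀ x ∈ uIcc y z, HasDerivAt F (1 / a x) x) :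
    invSq a ε y - invSq a ε z = 2 * (F z - F y) := by
  rw [← intervalIntegral.integral_eq_sub_of_hasDerivAt hF
    (intervalIntegrable_one_div ha hpos hy hz), invSq, invSq,
    ← intervalIntegral.integral_add_adjacent_intervals (intervalIntegrable_one_div ha hpos hy hz)
      (intervalIntegrable_one_div ha hpos hz hε)]
  ring

theorem le_invSq (hpos : ∀ y ∈ Ioo (0 : ℝ) (1 / 4), 0 < a y)
    (hε : ε ∈ Ioo (0 : ℝ) (1 / 4)) {y : ℝ} (hy : 0 < y) (hyε : y ≤ ε) :
    1 / ε ^ 2 ≤ invSq a ε y := by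
  have := intervalIntegral.integral_nonneg hyε (f := fun z => 1 / a z)
    (μ := MeasureTheory.volume) fun z hz =>
      (one_div_pos.2 (hpos z ⟨hy.trans_le hz.1, hz.2.trans_lt hε.2⟩)).le
  rw [invSq]
  linarith

theorem invSq_eq_of_le (ha : Continuous a) (hpos : ∀ y ∈ Ioo (0 : ℝ) (1 / 4), 0 < a y)
    (hε : ε ∈ Ioo (0 : ℝ) (1 / 4)) (hcub : ∀ y ∈ Ico ε (1 / 4), a y = y ^ 3) {y : ℝ}
    (hy : y ∈ Ico ε (1 / 4)) : invSq a ε y = 1 / y ^ 2 := by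
  have hF : ∀ x ∈ uIcc y ε, HasDerivAt (fun z : ℝ => -(1 / 2) * (z ^ 2)⁻¹) (1 / a x) x := by
    intro x hx
    rw [uIcc_of_ge hy.1] at hx
    have hx0 : 0 < x := hε.1.trans_le hx.1
    rw [hcub x ⟨hx.1, hx.2.trans_lt hy.2⟩]
    have e := ((hasDerivAt_pow 2 x).fun_inv (by positivity)).const_mul (-(1 / 2) : ℝ)
    refine e.congr_deriv ?_
    field_simp
    norm_num
  have e := invSq_sub ha hpos hε ⟨hε.1.trans_le hy.1, hy.2⟩ hε hF
  have e2 : invSq a ε ε = 1 / ε ^ 2 := by simp [invSq]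
  rw [e2] at e
  have : invSq a ε y = 1 / ε ^ 2 + 2 * (-(1 / 2) * (ε ^ 2)⁻¹ - -(1 / 2) * (y ^ 2)⁻¹) := by linarith
  rw [this]
  ring

theorem exists_invSq_eq_log (ha : Continuous a) (hpos : ∀ y ∈ Ioo (0 : ℝ) (1 / 4), 0 < a y)
    (hε : ε ∈ Ioo (0 : ℝ) (1 / 4)) (hδ : 0 < δ) (hδε : δ < ε)
    (hlin : ∀ y ∈ Ioo 0 δ, a y = y) :
    ∃ c, ∀ y ∈ Ioo 0 δ, invSq a ε y = c - 2 * Real.log y := by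
  refine ⟨invSq a ε (δ / 2) + 2 * Real.log (δ / 2), fun y hy => ?_⟩
  have hδ2 : δ / 2 ∈ Ioo 0 δ := ⟨by linarith, by linarith⟩
  have hsub : ∀ y ∈ Ioo 0 δ, y ∈ Ioo (0 : ℝ) (1 / 4) := fun y hy =>
    ⟨hy.1, by linarith [hy.2, hε.2]⟩
  have e := invSq_sub ha hpos hε (hsub y hy) (hsub _ hδ2) (F := Real.log) fun x hx => by
    have hx' := ordConnected_Ioo.uIcc_subset hy hδ2 hx
    rw [hlin x hx', one_div]
    exact Real.hasDerivAt_log hx'.1.ne'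
  linarith

/-- The solution of `a u' = u³` with `u ε = ε`, extended by `0` to the left and by the identity to
the right. As `u = (c - 2 log y) ^ (-1/2)` near `0`, it is continuous at `0`, with infinite
slope. -/
theorem exists_half_profile (hε : ε ∈ Ioo (0 : ℝ) (1 / 4)) (hδ : 0 < δ) (hδε : δ < ε)
    (ha : ContDiff ℝ ∞ a) (hpos : ∀ y ∈ Ioo (0 : ℝ) (1 / 4), 0 < a y)
    (hcub : ∀ y ∈ Ico ε (1 / 4), a y = y ^ 3) (hlin : ∀ y ∈ Ioo 0 δ, a y = y) :
    ∃ (c : ℝ) (u u' : ℝ → ℝ), 0 < c ∧ (∀ y ≤ 0, u y = 0) ∧ (∀ y ≤ 0, u' y = 0) ∧ Continuous u ∧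
      (∀ y, 0 < y → ContDiffAt ℝ ∞ u y ∧ HasDerivAt u (u' y) y ∧ c ≤ u' y) ∧
      (∀ y, ε ≤ y → u y = y ∧ u' y = 1) ∧
      ∀ y ∈ Ioo 0 ε, a y * u' y = u y ^ 3 ∧ 0 ≤ u y ∧ u y ≤ ε := by
  have hac := ha.continuous
  set q := invSq a ε with hq
  have hε0 := hε.1
  have hqpos : ∀ y ∈ Ioo (0 : ℝ) (1 / 4), 0 < q y := fun y hy => by
    rcases le_total y ε with h | h
    · exact lt_of_lt_of_le (by positivity) (le_invSq hpos hε hy.1 h)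
    · rw [hq, invSq_eq_of_le hac hpos hε hcub ⟨h, hy.2⟩]
      have := hy.1
      positivity
  have hqd : ∀ y ∈ Ioo (0 : ℝ) (1 / 4), HasDerivAt q (-2 / a y) y := fun y hy =>
    hasDerivAt_invSq hac hpos hε hy
  have hqs : ContDiffOn ℝ ∞ q (Ioo (0 : ℝ) (1 / 4)) := by
    rw [contDiffOn_infty_iff_deriv_of_isOpen isOpen_Ioo]
    refine ⟨fun y hy => (hqd y hy).differentiableAt.differentiableWithinAt, ?_⟩
    exact (contDiffOn_const.div ha.contDiffOn fun y hy => (hpos y hy).ne').congr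
      fun y hy => (hqd y hy).deriv
  set w : ℝ → ℝ := fun y => (√(q y))⁻¹ with hw
  have hws : ∀ y ∈ Ioo (0 : ℝ) (1 / 4), ContDiffAt ℝ ∞ w y := fun y hy =>
    ((hqs.contDiffAt (isOpen_Ioo.mem_nhds hy)).sqrt (hqpos y hy).ne').inv
      (Real.sqrt_ne_zero'.2 (hqpos y hy))
  have hwd : ∀ y ∈ Ioo (0 : ℝ) (1 / 4), HasDerivAt w (w y ^ 3 / a y) y := fun y hy => by
    have hs := Real.sqrt_pos.2 (hqpos y hy)
    refine (((hqd y hy).sqrt (hqpos y hy).ne').fun_inv hs.ne').congr_deriv ?_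
    have := (hpos y hy).ne'
    simp only [hw]
    field_simp
  have hwε : ∀ y ∈ Ico ε (1 / 4), w y = y := fun y hy => by
    have hy0 : 0 < y := hε0.trans_le hy.1
    simp only [hw, hq, invSq_eq_of_le hac hpos hε hcub hy]
    rw [one_div, Real.sqrt_inv, inv_inv, Real.sqrt_sq hy0.le]
  have hwle : ∀ y ∈ Ioo 0 ε, w y ≤ ε := fun y hy => by
    have h1 := Real.sqrt_le_sqrt (le_invSq hpos hε hy.1 hy.2.le)
    rw [one_div, Real.sqrt_inv, Real.sqrt_sq hε0.le] at h1
    exact inv_le_of_inv_le₀ hε0 h1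
  have hwpos : ∀ y ∈ Ioo (0 : ℝ) (1 / 4), 0 < w y := fun y hy =>
    inv_pos.2 (Real.sqrt_pos.2 (hqpos y hy))
  obtain ⟨c, hc⟩ := exists_invSq_eq_log hac hpos hε hδ hδε hlin
  -- lower bound for the derivative near `0`, from `exp (q / 2) ≥ q ^ 2 / 8`
  have hnear : ∀ y ∈ Ioo 0 δ, Real.exp (-(c / 2)) / 8 ≤ w y ^ 3 / a y := fun y hy => by
    have hy' : y ∈ Ioo (0 : ℝ) (1 / 4) := ⟨hy.1, by linarith [hy.2, hε.2]⟩
    set s := √(q y) with hs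
    have hsq : s ^ 2 = q y := Real.sq_sqrt (hqpos y hy').le
    have hs1 : 1 ≤ s := by
      rw [hs, Real.one_le_sqrt]
      refine le_trans ?_ (le_invSq hpos hε hy.1 (by linarith [hy.2]))
      rw [le_div_iff₀ (by positivity)]
      nlinarith [hε.1, hε.2]
    have hy1 : y = (Real.exp (q y / 2) * Real.exp (-(c / 2)))⁻¹ := by
      rw [← Real.exp_add, ← Real.exp_neg, ← Real.exp_log hy.1]
      congr 1
      rw [Real.exp_log hy.1, hq, hc y hy]
      ring
    have hexp : s ^ 4 / 8 ≤ Real.exp (q y / 2) := by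
      have := Real.quadratic_le_exp_of_nonneg (show 0 ≤ q y / 2 by linarith [hqpos y hy'])
      rw [← hsq] at this ⊢
      nlinarith [sq_nonneg s]
    rw [hlin y hy, show w y = s⁻¹ from rfl, le_div_iff₀ hy.1]
    have h3 : s ^ 4 / 8 * Real.exp (-(c / 2)) ≤ Real.exp (q y / 2) * Real.exp (-(c / 2)) :=
      mul_le_mul_of_nonneg_right hexp (Real.exp_pos _).le
    have h4 : y ≤ (s ^ 4 / 8 * Real.exp (-(c / 2)))⁻¹ :=
      hy1.trans_le (inv_anti₀ (by positivity) h3)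
    calc Real.exp (-(c / 2)) / 8 * y
        ≤ Real.exp (-(c / 2)) / 8 * (s ^ 4 / 8 * Real.exp (-(c / 2)))⁻¹ :=
          mul_le_mul_of_nonneg_left h4 (by positivity)
      _ = (s ^ 4)⁻¹ := by
          have := (Real.exp_pos (-(c / 2))).ne'
          field_simp
      _ ≤ s⁻¹ ^ 3 := by
          rw [inv_pow]
          exact inv_anti₀ (by positivity) (pow_le_pow_right₀ hs1 (by norm_num))
  obtain ⟨y₀, hy₀, hmin⟩ := (isCompact_Icc (a := δ / 2) (b := ε)).exists_isMinOn
    ⟨ε, by constructor <;> linarith⟩ (f := fun y => w y ^ 3 / a y) (by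
      intro y hy
      have hy' : y ∈ Ioo (0 : ℝ) (1 / 4) := ⟨by linarith [hy.1], by linarith [hy.2, hε.2]⟩
      exact (((hws y hy').continuousAt.pow 3).div hac.continuousAt
        (hpos y hy').ne').continuousWithinAt)
  have hy₀' : y₀ ∈ Ioo (0 : ℝ) (1 / 4) := ⟨by linarith [hy₀.1], by linarith [hy₀.2, hε.2]⟩
  set c₁ := min 1 (min (Real.exp (-(c / 2)) / 8) (w y₀ ^ 3 / a y₀)) with hc₁
  have hc₁pos : 0 < c₁ := lt_min one_pos (lt_min (by positivity)
    (div_pos (pow_pos (hwpos y₀ hy₀') 3) (hpos y₀ hy₀')))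
  have hc₁le : ∀ y ∈ Ioo 0 ε, c₁ ≤ w y ^ 3 / a y := fun y hy => by
    rcases lt_or_ge y δ with h | h
    · exact ((min_le_right _ _).trans (min_le_left _ _)).trans (hnear y ⟨hy.1, h⟩)
    · exact ((min_le_right _ _).trans (min_le_right _ _)).trans
        (hmin ⟨by linarith, hy.2.le⟩)
  set u : ℝ → ℝ := fun y => if y ≤ 0 then 0 else if y < ε then w y else y with hu
  set u' : ℝ → ℝ := fun y => if y ≤ 0 then 0 else if y < ε then w y ^ 3 / a y else 1 with hu'
  have hu1 : ∀ y ∈ Ioo 0 ε, u y = w y := fun y hy => by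
    simp only [hu, if_neg hy.1.not_ge, if_pos hy.2]
  have hu2 : ∀ y, ε ≤ y → u y = y := fun y hy => by
    simp only [hu, if_neg (hε0.trans_le hy).not_ge, if_neg hy.not_gt]
  have hu3 : ∀ y ∈ Ioo (0 : ℝ) (1 / 4), u y = w y := fun y hy => by
    rcases lt_or_ge y ε with h | h
    · exact hu1 y ⟨hy.1, h⟩
    · rw [hu2 y h, hwε y ⟨h, hy.2⟩]
  have hu0 : ∀ y ≤ 0, u y = 0 := fun y hy => by simp only [hu, if_pos hy]
  have hu'1 : ∀ y ∈ Ioo 0 ε, u' y = w y ^ 3 / a y := fun y hy => by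
    simp only [hu', if_neg hy.1.not_ge, if_pos hy.2]
  have hu'2 : ∀ y, ε ≤ y → u' y = 1 := fun y hy => by
    simp only [hu', if_neg (hε0.trans_le hy).not_ge, if_neg hy.not_gt]
  have hu'3 : ∀ y ∈ Ioo (0 : ℝ) (1 / 4), u' y = w y ^ 3 / a y := fun y hy => by
    rcases lt_or_ge y ε with h | h
    · exact hu'1 y ⟨hy.1, h⟩
    · have := hy.1
      rw [hu'2 y h, hwε y ⟨h, hy.2⟩, hcub y ⟨h, hy.2⟩, div_self (by positivity)]
  have hmain : ∀ y, 0 < y → ContDiffAt ℝ ∞ u y ∧ HasDerivAt u (u' y) y ∧ c₁ ≤ u' y := by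
    intro y hy
    refine ⟨?_, ?_, ?_⟩
    · rcases lt_or_ge y (1 / 4) with h | h
      · refine (hws y ⟨hy, h⟩).congr_of_eventuallyEq ?_
        filter_upwards [Ioo_mem_nhds hy h] with z hz using hu3 z hz
      · refine contDiffAt_id.congr_of_eventuallyEq ?_
        filter_upwards [Ioi_mem_nhds (hε.2.trans_le h)] with z hz using hu2 z (le_of_lt hz)
    · rcases lt_or_ge y (1 / 4) with h | h
      · rw [hu'3 y ⟨hy, h⟩]
        refine (hwd y ⟨hy, h⟩).congr_of_eventuallyEq ?_
        filter_upwards [Ioo_mem_nhds hy h] with z hz using hu3 z hz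
      · rw [hu'2 y (hε.2.le.trans h)]
        refine (hasDerivAt_id y).congr_of_eventuallyEq ?_
        filter_upwards [Ioi_mem_nhds (hε.2.trans_le h)] with z hz using hu2 z (le_of_lt hz)
    · rcases lt_or_ge y ε with h | h
      · rw [hu'1 y ⟨hy, h⟩]; exact hc₁le y ⟨hy, h⟩
      · rw [hu'2 y h]; exact min_le_left _ _
  refine ⟨c₁, u, u', hc₁pos, hu0, fun y hy => by simp only [hu', if_pos hy], ?_, hmain,
    fun y hy => ⟨hu2 y hy, hu'2 y hy⟩, fun y hy => ⟨?_, ?_, ?_⟩⟩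
  · rw [continuous_iff_continuousAt]
    intro y
    rcases lt_trichotomy y 0 with h | rfl | h
    · refine (continuousAt_const (y := (0 : ℝ))).congr ?_
      filter_upwards [Iio_mem_nhds h] with z hz using (hu0 z (le_of_lt hz)).symm
    · rw [continuousAt_iff_continuous_left_right, ← continuousWithinAt_Ioi_iff_Ici]
      constructor
      · exact continuousWithinAt_const.congr (fun z hz => hu0 z hz) (hu0 0 le_rfl)
      · rw [ContinuousWithinAt, hu0 0 le_rfl]
        have e1 : Tendsto (fun y => c - 2 * Real.log y) (𝓝[>] 0) atTop :=
          tendsto_atTop_add_const_left _ c (tendsto_neg_atBot_atTop.comp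
            (Real.tendsto_log_nhdsGT_zero.const_mul_atBot two_pos))
        have e2 := (Real.tendsto_sqrt_atTop.comp e1).inv_tendsto_atTop
        refine e2.congr' ?_
        filter_upwards [Ioo_mem_nhdsGT hδ] with z hz
        rw [hu1 z ⟨hz.1, hz.2.trans hδε⟩]
        simp only [hw, hq, hc z hz, Pi.inv_apply, Function.comp]
    · exact (hmain y h).1.continuousAt
  · rw [hu'1 y hy, hu1 y hy, mul_div_cancel₀ _ (hpos y ⟨hy.1, hy.2.trans hε.2⟩).ne']
  · rw [hu1 y hy]; exact (hwpos y ⟨hy.1, hy.2.trans hε.2⟩).le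
  · rw [hu1 y hy]; exact hwle y hy

end HalfProfile

theorem MemClass.exists_isProfile {g f : UnitAddCircle → ℝ} {ε : ℝ} (hg : IsModel g) (hε : 0 < ε)
    (hε' : ε < 1 / 4) (hf : MemClass ε g f) :
    ∃ (θ : ℝ) (h h' : ℝ → ℝ), IsProfile ε θ h h' ∧
      (∀ y : ℝ, |y| ≤ 1 / 2 → y ≠ 0 →
        f (y : UnitAddCircle) * h' y = g ((h y : ℝ) : UnitAddCircle)) ∧
      ∀ y, |y| < ε → |h y| ≤ ε := by
  obtain ⟨δ, hδ, hδε, hlin⟩ := hf.linear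
  obtain ⟨c, u, u', hc, hu0, hu'0, huc, hu, hufar, hunear⟩ := exists_half_profile
    (a := fun y => -f (y : UnitAddCircle)) ⟨hε, hε'⟩ hδ hδε hf.smooth.neg
    (fun y hy => neg_pos.2 (hf.neg_of_pos hg ⟨hy.1, by linarith [hy.2]⟩))
    (fun y hy => by
      rw [hf.eq_model y ⟨by linarith [hy.1], by linarith [hy.2]⟩ fun h => hy.1.not_gt h.2,
        hg.cubic y ⟨by linarith [hy.1], hy.2.le⟩, neg_neg])
    (fun y hy => by rw [hlin y ⟨by linarith [hy.1], hy.2⟩, neg_neg])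
  set h : ℝ → ℝ := fun y => u y - u (-y) with hh
  set h' : ℝ → ℝ := fun y => if y = 0 then c / 2 else u' y + u' (-y) with hh'
  have hp : ∀ y, 0 ≤ y → h y = u y := fun y hy => by
    simp only [hh, hu0 (-y) (by linarith), sub_zero]
  have hn : ∀ y, y ≤ 0 → h y = -u (-y) := fun y hy => by simp only [hh, hu0 y hy, zero_sub]
  have hp' : ∀ y, 0 < y → h' y = u' y := fun y hy => by
    simp only [hh', if_neg hy.ne', hu'0 (-y) (by linarith), add_zero]
  have hn' : ∀ y, y < 0 → h' y = u' (-y) := fun y hy => by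
    simp only [hh', if_neg hy.ne, hu'0 y hy.le, zero_add]
  have hpev : ∀ y, 0 < y → h =ᶠ[𝓝 y] u := fun y hy => by
    filter_upwards [Ioi_mem_nhds hy] with z hz using hp z (le_of_lt hz)
  have hnev : ∀ y, y < 0 → h =ᶠ[𝓝 y] fun z => -u (-z) := fun y hy => by
    filter_upwards [Iio_mem_nhds hy] with z hz using hn z (le_of_lt hz)
  refine ⟨c / 2, h, h', ⟨by positivity, ?_, ?_, by fun_prop, ?_, ?_, ?_, ?_⟩, ?_, ?_⟩
  · intro y hy
    rcases le_total 0 y with h0 | h0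
    · rw [hp y h0, (hufar y (by rwa [abs_of_nonneg h0] at hy)).1]
    · rw [hn y h0, (hufar (-y) (by rwa [abs_of_nonpos h0] at hy)).1, neg_neg]
  · rw [hp 0 le_rfl, hu0 0 le_rfl]
  · intro y hy
    rcases lt_or_gt_of_ne hy with h0 | h0
    · refine ContDiffAt.congr_of_eventuallyEq ?_ (hnev y h0)
      exact (((hu (-y) (by linarith)).1).comp y contDiff_neg.contDiffAt).neg
    · exact (hu y h0).1.congr_of_eventuallyEq (hpev y h0)
  · intro y hy
    rcases lt_or_gt_of_ne hy with h0 | h0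
    · refine HasDerivAt.congr_of_eventuallyEq ?_ (hnev y h0)
      rw [hn' y h0]
      have := ((hu (-y) (by linarith)).2.1.comp y (hasDerivAt_neg y)).fun_neg
      simpa using this
    · rw [hp' y h0]
      exact (hu y h0).2.1.congr_of_eventuallyEq (hpev y h0)
  · simp only [hh', if_pos]
  · intro y hy
    rcases lt_or_gt_of_ne hy with h0 | h0
    · rw [hn' y h0]; linarith [(hu (-y) (by linarith)).2.2]
    · rw [hp' y h0]; linarith [(hu y h0).2.2]
  · intro y hy hy0
    have hy' := abs_le.1 hy
    by_cases hnear : |y| < ε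
    · rcases lt_or_gt_of_ne hy0 with h0 | h0
      · rw [abs_of_neg h0] at hnear
        have hm : -y ∈ Ioo 0 ε := ⟨by linarith, hnear⟩
        obtain ⟨e1, e2, e3⟩ := hunear (-y) hm
        have e4 := hf.odd (-y) hm
        rw [neg_neg] at e4
        rw [hn' y h0, hn y h0.le, hg.cubic _ ⟨by linarith, by linarith⟩]
        rw [e4, neg_neg] at e1
        rw [e1]
        ring
      · rw [abs_of_pos h0] at hnear
        obtain ⟨e1, e2, e3⟩ := hunear y ⟨h0, hnear⟩
        rw [hp' y h0, hp y h0.le, hg.cubic _ ⟨by linarith, by linarith⟩]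
        linarith
    · rw [not_lt] at hnear
      have e : f (y : UnitAddCircle) = g (y : UnitAddCircle) := by
        rcases eq_or_lt_of_le hy'.2 with rfl | h1
        · have e : ((1 / 2 : ℝ) : UnitAddCircle) = ((-1 / 2 : ℝ) : UnitAddCircle) := by
            rw [← AddCircle.coe_add_period 1 (-1 / 2)]
            norm_num
          rw [e, hf.apply_neg_half hg hε', hg.zero]
        · exact hf.eq_model y ⟨by linarith [hy'.1], h1⟩ fun h => hnear.not_gt (abs_lt.2 h)
      rcases lt_or_gt_of_ne hy0 with h0 | h0
      · obtain ⟨e1, e2⟩ := hufar (-y) (by rwa [abs_of_neg h0] at hnear)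
        rw [hn' y h0, hn y h0.le, e1, e2, neg_neg, e, mul_one]
      · obtain ⟨e1, e2⟩ := hufar y (by rwa [abs_of_pos h0] at hnear)
        rw [hp' y h0, hp y h0.le, e1, e2, e, mul_one]
  · intro y hy
    rcases lt_trichotomy y 0 with h0 | rfl | h0
    · obtain ⟨-, e2, e3⟩ := hunear (-y) ⟨by linarith, by rwa [abs_of_neg h0] at hy⟩
      rw [hn y h0.le, abs_neg, abs_of_nonneg e2]
      exact e3
    · rw [hp 0 le_rfl, hu0 0 le_rfl, abs_zero]
      exact hε.le
    · obtain ⟨-, e2, e3⟩ := hunear y ⟨h0, by rwa [abs_of_pos h0] at hy⟩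
      rw [hp y h0.le, abs_of_nonneg e2]
      exact e3

/-! ### The contact homeomorphism carrying `S_f` to `S_g` -/

theorem MemClass.exists_isContactHomeomorphism {g f : UnitAddCircle → ℝ} {ε : ℝ} (hg : IsModel g)
    (hε : 0 < ε) (hε' : ε < 1 / 4) (hf : MemClass ε g f) :
    ∃ Φ : Y ≃ₜ Y, IsContactHomeomorphism Φ ∧ Φ '' torus f = torus g := by
  obtain ⟨θ, h, h', hh, hfg, hsmall⟩ := hf.exists_isProfile hg hε hε'
  obtain ⟨K, hK, hscale⟩ := exists_isScale
  -- the bound `m₀ * K ≤ 1` keeps the scale `m 0 R ≤ m₀ K R²` below `h y` when `R = -(h y)³`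
  obtain ⟨m, hm⟩ := hscale (min ε (1 / K)) (lt_min hε (by positivity))
  have hm₀ : min ε (1 / K) * K ≤ 1 := by
    rw [← le_div_iff₀ hK]; exact min_le_right _ _
  have hμ : 0 < 1 / (4 * K) := by positivity
  obtain ⟨S, hS⟩ := exists_isSlowStep hμ
  have hKμ : 4 * K * (1 / (4 * K)) ≤ 1 := (mul_one_div_cancel (by positivity)).le
  refine ⟨(mixedFamily_gen hε hε' hh hS hm (min_le_left _ _) hK hμ hKμ).homeo 0,
    MixedFamily.isContactHomeomorphism_homeo_zero _ fun σ hσ =>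
      isContactomorphism_gen hε hε' hh hS hm (min_le_left _ _) hK hμ hKμ hσ,
    homeo_zero_image_torus hε hε' hh hS hm (min_le_left _ _) hK hμ hKμ hf.apply_zero hfg ?_ ?_⟩
  · simpa using hg.cubic 0 (by norm_num)
  · intro y _
    rcases lt_or_ge |y| ε with hy | hy
    · have h1 := hsmall y hy
      have h2 := abs_le.1 h1
      rw [hg.cubic _ ⟨by linarith, by linarith⟩]
      have h3 := abs_nonneg (h y)
      calc m 0 (-h y ^ 3) ≤ min ε (1 / K) * K * (-h y ^ 3) ^ 2 := hm.le_sq _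
        _ ≤ 1 * (-h y ^ 3) ^ 2 := mul_le_mul_of_nonneg_right hm₀ (sq_nonneg _)
        _ = |h y| * |h y| ^ 5 := by
          rw [one_mul, neg_sq, ← pow_mul, ← pow_succ', Even.pow_abs (by decide)]
        _ ≤ |h y| * 1 :=
          mul_le_mul_of_nonneg_left (pow_le_one₀ h3 (by linarith)) h3
        _ = |h y| := mul_one _
    · rw [hh.eq_self y hy]
      exact (hm.le _ _).trans ((min_le_left _ _).trans hy)

end ContactFlex

theorem theorem1p3 (g : UnitAddCircle → ℝ) (hg : ContactFlex.IsModel g)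
    (ε : ℝ) (hε : 0 < ε) (hε' : ε < 1 / 4)
    (f : UnitAddCircle → ℝ) (hf : ContactFlex.MemClass ε g f) :
    ContactFlex.IsConvexSurface (ContactFlex.torus f) ∧
    ¬ ContactFlex.IsConvexSurface (ContactFlex.torus g) ∧
    ∃ Φ : ContactFlex.Y ≃ₜ ContactFlex.Y,
      ContactFlex.IsContactHomeomorphism Φ ∧
      Φ '' ContactFlex.torus f = ContactFlex.torus g :=
  ⟨hf.isConvexSurface hg hε', hg.not_isConvexSurface,
    hf.exists_isContactHomeomorphism hg hε hε'⟩
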